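/- Let $\mathbb N=\{0,1,2,\dots\}$. For $\theta=(r,d_1,a_1,b_1,d_2,a_2,b_2)$ with $r\in\mathbb N$, $y\in\mathbb N$ and $\ell\ge 0$ put $$g_\theta(y,\ell)=\begin{cases} d_1+a_1\ell+b_1y,& y\le r,\\ d_2+a_2\ell+b_2y,& y>r.\end{cases}$$ Let $\mathbf\Theta$ be the set of $(d_1,a_1,b_1,d_2,a_2,b_2)\in(0,\infty)^6$ with $a_1<1$, $b_1<1$, $a_2+b_2<1$, let $\mathcal D\subset\mathbf\Theta$ be compact with interior $\mathcal D^o$, let $r_*\in\mathbb N$, and let $\theta_0=(r_0,d_1,a_1,b_1,d_2,a_2,b_2)\in\{0,\dots,r_*\}\times\mathcal D^o$. Let $(Y_t)_{t\in\mathbb Z}$ be $\mathbb N$-valued random variables following the self-excited threshold Poisson autoregression with parameter $\theta_0$: with $\mathcal F_t=\sigma(Y_s,\,s\le t)$, the conditional law of $Y_t$ given $\mathcal F_{t-1}$ is Poisson with mean $\lambda_t$, where $\lambda_t=g_{\theta_0}(Y_{t-1},\lambda_{t-1})$ for all $t\in\mathbb Z$ (stationarity is not assumed). Fix an initial value $\tilde\lambda_1>0$,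 put $\tilde\lambda_1(\theta)=\tilde\lambda_1$ and $\tilde\lambda_t(\theta)=g_\theta(Y_{t-1},\tilde\lambda_{t-1}(\theta))$ for $t\ge 2$, and for each $n\ge 1$ let $\hat\theta=\hat\theta_n$ be any maximizer of the conditional log-likelihood $$\tilde\ell(\theta)=\sum_{t=1}^n\bigl(-\tilde\lambda_t(\theta)+Y_t\log\tilde\lambda_t(\theta)\bigr)$$ over $\theta\in\{0,\dots,r_*\}\times\mathcal D$, the threshold being estimated jointly with the other parameters. (i) Suppose that $\theta_0$ is nondegenerate, in the sense that $r_0\ge 1$ and that, if $a_1=a_2$, then $d_1+b_1r_0\ne d_2+b_2r_0$ and, in case $r_0<r_*$, also $d_1+b_1(r_0+1)\ne d_2+b_2(r_0+1)$. Then $\hat\theta_n$ is strongly consistent: almost surely $\hat\theta_n\to\theta_0$ as $n\to\infty$; in particular $\hat r_n=r_0$ for all sufficiently large $n$. (ii) Whether or not $\theta_0$ is nondegenerate, almost surely the distance from $\hat\theta_n$ to the set of those $\theta\in\{0,\dots,r_*\}\times\mathcal D$ with $g_\theta(y,\ell)=g_{\theta_0}(y,\ell)$ for all $y\in\mathbb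 N$, $\ell>0$ tends to $0$. -/

import Mathlib

open MeasureTheory ProbabilityTheory Filter Topology
open scoped NNReal

noncomputable section

namespace SETPAR

/-- The regression parameters `(d₁, a₁, b₁, d₂, a₂, b₂)`, as a vector of `ℝ⁶`. -/
abbrev Coef : Type := EuclideanSpace ℝ (Fin 6)

/-- The full parameter `θ = (r, (d₁, a₁, b₁, d₂, a₂, b₂))`, with `r` the integer threshold. The
topology is the product of the discrete topology of `ℕ` and the usual one of `ℝ⁶`. -/
abbrev Param : Type := ℕ × Coef

/-- Intercept of the lower regime. -/
def Param.d₁ (θ : Param) : ℝ := θ.2 0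
/-- Coefficient of the previous intensity in the lower regime. -/
def Param.a₁ (θ : Param) : ℝ := θ.2 1
/-- Coefficient of the previous count in the lower regime. -/
def Param.b₁ (θ : Param) : ℝ := θ.2 2
/-- Intercept of the upper regime. -/
def Param.d₂ (θ : Param) : ℝ := θ.2 3
/-- Coefficient of the previous intensity in the upper regime. -/
def Param.a₂ (θ : Param) : ℝ := θ.2 4
/-- Coefficient of the previous count in the upper regime. -/
def Param.b₂ (θ : Param) : ℝ := θ.2 5

/-- The set `Θ` of all vectors with strictly positive entries and
`a₁ < 1`, `b₁ < 1`, `a₂ + b₂ < 1`. -/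
def bigTheta : Set Coef :=
  {x | (∀ i, 0 < x i) ∧ x 1 < 1 ∧ x 2 < 1 ∧ x 4 + x 5 < 1}

/-- The parameter space `([0, r_*] ∩ ℕ) × D`. -/
def paramSpace (rstar : ℕ) (D : Set Coef) : Set Param :=
  {θ | θ.1 ≤ rstar ∧ θ.2 ∈ D}

/-- The threshold recursion: the intensity `λ_t` as a function of the previous count
`y = Y_{t-1}` and of the previous intensity `l = λ_{t-1}`. -/
def intensity (θ : Param) (y : ℕ) (l : ℝ) : ℝ :=
  if y ≤ θ.1 then Param.d₁ θ + Param.a₁ θ * l + Param.b₁ θ * (y : ℝ)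
  else Param.d₂ θ + Param.a₂ θ * l + Param.b₂ θ * (y : ℝ)

/-- The σ-algebra `F_t = σ(Y_s, s ≤ t)`. -/
abbrev past {Ω : Type*} (Y : ℤ → Ω → ℕ) (t : ℤ) : MeasurableSpace Ω :=
  ⨆ s : {s : ℤ // s ≤ t}, MeasurableSpace.comap (Y s) ⊤

/-- `Y = (Y_t)_{t ∈ ℤ}` follows the self-excited threshold Poisson autoregression with parameter
`θ` and intensity process `lam = (λ_t)_{t ∈ ℤ}`: the conditional law of `Y_t` given `F_{t-1}` is
Poisson with mean `λ_t`, and `λ_t` satisfies the threshold recursion. (The first property makes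
`λ_t` almost surely equal to an `F_{t-1}`-measurable variable; stationarity is not required.) -/
structure IsSETPAR {Ω : Type*} [MeasurableSpace Ω] (P : Measure Ω) (θ : Param)
    (Y : ℤ → Ω → ℕ) (lam : ℤ → Ω → ℝ≥0) : Prop where
  measurable : ∀ t, Measurable (Y t)
  condLaw : ∀ (t : ℤ) (A : Set ℕ),
    P[(Y t ⁻¹' A).indicator (fun _ => (1 : ℝ)) | past Y (t - 1)]
      =ᵐ[P] fun ω => (poissonMeasure (lam t ω)).real A
  recursion : ∀ t : ℤ, ∀ᵐ ω ∂P,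
    (lam t ω : ℝ) = intensity θ (Y (t - 1) ω) (lam (t - 1) ω)

/-- The sequence `λ̃_1, λ̃_2, …` computed by the recursion from the initial value `l₁ = λ̃_1` and
the observations `y 1, y 2, …`. (The value at index `0` is a dummy, never used.) -/
def tildeLam (l₁ : ℝ) (y : ℕ → ℕ) (θ : Param) : ℕ → ℝ
  | 0 => l₁
  | 1 => l₁
  | t + 2 => intensity θ (y (t + 1)) (tildeLam l₁ y θ (t + 1))

/-- The conditional log-likelihood (up to a constant) of the observations `y 1, …, y n`. -/
def logLik (l₁ : ℝ) (y : ℕ → ℕ) (n : ℕ) (θ : Param) : ℝ :=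
  ∑ t ∈ Finset.Icc 1 n,
    (-tildeLam l₁ y θ t + (y t : ℝ) * Real.log (tildeLam l₁ y θ t))

/-- `θhat` is a maximum likelihood estimate: it belongs to the parameter space `S` and maximizes
the conditional log-likelihood of `y 1, …, y n` over `S`, jointly in all seven parameters. -/
def IsMLE (S : Set Param) (l₁ : ℝ) (y : ℕ → ℕ) (n : ℕ) (θhat : Param) : Prop :=
  θhat ∈ S ∧ ∀ θ ∈ S, logLik l₁ y n θ ≤ logLik l₁ y n θhat

/-- The parameter determines the model among thresholds at most `rstar`: the lower regime contains
a positive count (otherwise `b₁` never enters the recursion), and the two regimes do not agree on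
`y = r`, nor on `y = r + 1` if `r + 1` is an admissible threshold (otherwise moving the threshold
by one does not change the recursion). This forces `(d₁, a₁, b₁) ≠ (d₂, a₂, b₂)`. -/
def Nondegenerate (rstar : ℕ) (θ : Param) : Prop :=
  1 ≤ θ.1 ∧
  (Param.a₁ θ = Param.a₂ θ →
    Param.d₁ θ + Param.b₁ θ * (θ.1 : ℝ) ≠ Param.d₂ θ + Param.b₂ θ * (θ.1 : ℝ) ∧
    (θ.1 < rstar →
      Param.d₁ θ + Param.b₁ θ * ((θ.1 : ℝ) + 1) ≠ Param.d₂ θ + Param.b₂ θ * ((θ.1 : ℝ) + 1)))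

/-- The parameters in `S` that define literally the same recursion as `θ₀`. -/
def sameModel (S : Set Param) (θ₀ : Param) : Set Param :=
  {θ ∈ S | ∀ (y : ℕ) (l : ℝ), 0 < l → intensity θ y l = intensity θ₀ y l}

end SETPAR

end

noncomputable section

namespace SETPAR

/-! Write `Λ` for the true intensities, `N` for the counts and `T` for the intensities computed from
a parameter. If a count is replaced by its conditional mean, a summand of the log-likelihood becomes
`-T + Λ log T`, which is maximal at `T = Λ` and otherwise falls short of its maximum by at least
`(√T - √Λ)²`. A maximizer does at least as well as `θ₀`, so the sum of `(√T - √Λ)²` at the estimate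
is bounded by a difference of martingale terms `Σ (N - Λ) log T` plus the cost of starting the
recursion of `θ₀` at the wrong initial value (`sum_hellinger_le_of_isMLE`). That cost is `o(n)`
because the recursion forgets its start geometrically. The martingale terms are `o(n)` on a
countable dense set of parameters by a strong law, and at fixed threshold they vary by at most
`O(n)` times the distance of the parameters (`abs_noise_sub_le`). Hence at every limit point `θ` of
the estimates the averages of `(√T - √Λ)²` vanish along a subsequence.

Such a `θ` defines the recursion of `θ₀`. Every pair `(y', y)` of consecutive counts occurs with
positive lower frequency at bounded intensity (`exists_pattern_frequency`). At some occurrences the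
two intensities are close both before and after the count `y`, so the two recursions at `y` agree
somewhere in a compact interval. The choices `y' = 0` and `y'` large give disjoint intervals, and
affine functions of `l` that agree twice are equal (`intensity_eq_of_tendsto_avg`). Compactness
gives (ii), and nondegeneracy shrinks the limit set to `{θ₀}` (`sameModel_eq_singleton`), which
gives (i). The limit set always contains `θ₀`, so `Metric.infDist` never takes its default value for
the empty set.

In place of ergodicity, moments come from an exponential drift (`exists_exp_drift`): counts are
bounded in the lower regime, so `a₁ < 1` suffices there, and `a₂ + b₂ < 1` controls the upper one.
Since `λ₁` need not have moments, the argument runs on the events `λ₁ ≤ K`, which exhaust the space.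
-/

/-- The intensities computed by the recursion with parameter `θ` from the initial value `l` and the
counts `N 0, N 1, …`. -/
def traj (θ : Param) (l : ℝ) (N : ℕ → ℕ) : ℕ → ℝ
  | 0 => l
  | i + 1 => intensity θ (N i) (traj θ l N i)

/-- Uniform bounds on the coefficients of a parameter. -/
structure CoefBound (δ ρ B : ℝ) (θ : Param) : Prop where
  lower : ∀ i, δ ≤ θ.2 i
  upper : ∀ i, θ.2 i ≤ B
  a₁_le : θ.2 1 ≤ ρ
  a₂_le : θ.2 4 ≤ ρ

/-! ### Deterministic bounds for the recursion -/

section Recursion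

variable {δ ρ B : ℝ} {θ θ' : Param}

lemma CoefBound.rho_pos (h : CoefBound δ ρ B θ) (hδ : 0 < δ) : 0 < ρ :=
  hδ.trans_le ((h.lower 1).trans h.a₁_le)

lemma CoefBound.B_pos (h : CoefBound δ ρ B θ) (hδ : 0 < δ) : 0 < B :=
  hδ.trans_le ((h.lower 1).trans (h.upper 1))

lemma le_intensity (h : CoefBound δ ρ B θ) (hδ : 0 < δ) (y : ℕ) {l : ℝ} (hl : 0 ≤ l) :
    δ ≤ intensity θ y l := by
  have h0 := h.lower
  have hy : (0 : ℝ) ≤ y := y.cast_nonneg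
  unfold intensity Param.d₁ Param.a₁ Param.b₁ Param.d₂ Param.a₂ Param.b₂
  split_ifs
  · have := mul_nonneg (hδ.le.trans (h0 1)) hl
    have := mul_nonneg (hδ.le.trans (h0 2)) hy
    linarith [h0 0]
  · have := mul_nonneg (hδ.le.trans (h0 4)) hl
    have := mul_nonneg (hδ.le.trans (h0 5)) hy
    linarith [h0 3]

lemma mul_count_le_intensity (h : CoefBound δ ρ B θ) (hδ : 0 < δ) (y : ℕ) {l : ℝ} (hl : 0 ≤ l) :
    δ * y ≤ intensity θ y l := by
  have h0 := h.lower
  have hy : (0 : ℝ) ≤ y := y.cast_nonneg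
  unfold intensity Param.d₁ Param.a₁ Param.b₁ Param.d₂ Param.a₂ Param.b₂
  split_ifs
  · have := mul_nonneg (hδ.le.trans (h0 1)) hl
    have := mul_le_mul_of_nonneg_right (h0 2) hy
    linarith [h0 0]
  · have := mul_nonneg (hδ.le.trans (h0 4)) hl
    have := mul_le_mul_of_nonneg_right (h0 5) hy
    linarith [h0 3]

lemma intensity_le (h : CoefBound δ ρ B θ) (y : ℕ) {l : ℝ} (hl : 0 ≤ l) :
    intensity θ y l ≤ ρ * l + B * (1 + y) := by
  have h0 := h.upper
  have hy : (0 : ℝ) ≤ y := y.cast_nonneg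
  unfold intensity Param.d₁ Param.a₁ Param.b₁ Param.d₂ Param.a₂ Param.b₂
  split_ifs
  · have := mul_le_mul_of_nonneg_right h.a₁_le hl
    have := mul_le_mul_of_nonneg_right (h0 2) hy
    linarith [h0 0]
  · have := mul_le_mul_of_nonneg_right h.a₂_le hl
    have := mul_le_mul_of_nonneg_right (h0 5) hy
    linarith [h0 3]

lemma abs_intensity_sub_le (h : CoefBound δ ρ B θ) (hδ : 0 < δ) (y : ℕ) (l l' : ℝ) :
    |intensity θ y l - intensity θ y l'| ≤ ρ * |l - l'| := by
  unfold intensity Param.d₁ Param.a₁ Param.b₁ Param.d₂ Param.a₂ Param.b₂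
  split_ifs
  · rw [show θ.2 0 + θ.2 1 * l + θ.2 2 * (y : ℝ) - (θ.2 0 + θ.2 1 * l' + θ.2 2 * (y : ℝ))
      = θ.2 1 * (l - l') by ring, abs_mul, abs_of_pos (hδ.trans_le (h.lower 1))]
    exact mul_le_mul_of_nonneg_right h.a₁_le (abs_nonneg _)
  · rw [show θ.2 3 + θ.2 4 * l + θ.2 5 * (y : ℝ) - (θ.2 3 + θ.2 4 * l' + θ.2 5 * (y : ℝ))
      = θ.2 4 * (l - l') by ring, abs_mul, abs_of_pos (hδ.trans_le (h.lower 4))]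
    exact mul_le_mul_of_nonneg_right h.a₂_le (abs_nonneg _)

lemma abs_affine_le {η d a b l y : ℝ} (hl : 0 ≤ l) (hy : 0 ≤ y) (hd : |d| ≤ η) (ha : |a| ≤ η)
    (hb : |b| ≤ η) : |d + a * l + b * y| ≤ η * (1 + l + y) := by
  have h1 : |a * l| ≤ η * l := by
    rw [abs_mul, abs_of_nonneg hl]; exact mul_le_mul_of_nonneg_right ha hl
  have h2 : |b * y| ≤ η * y := by
    rw [abs_mul, abs_of_nonneg hy]; exact mul_le_mul_of_nonneg_right hb hy
  have := abs_add_le (d + a * l) (b * y)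
  have := abs_add_le d (a * l)
  linarith

lemma abs_intensity_param_sub_le (hr : θ.1 = θ'.1) {η : ℝ} (hη : ∀ i, |θ.2 i - θ'.2 i| ≤ η)
    (y : ℕ) {l : ℝ} (hl : 0 ≤ l) :
    |intensity θ y l - intensity θ' y l| ≤ η * (1 + l + y) := by
  have hy : (0 : ℝ) ≤ y := y.cast_nonneg
  unfold intensity Param.d₁ Param.a₁ Param.b₁ Param.d₂ Param.a₂ Param.b₂
  rw [hr]
  split_ifs
  · convert abs_affine_le hl hy (hη 0) (hη 1) (hη 2) using 2
    ring
  · convert abs_affine_le hl hy (hη 3) (hη 4) (hη 5) using 2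
    ring

lemma traj_pos (h : CoefBound δ ρ B θ) (hδ : 0 < δ) {l : ℝ} (hl : 0 < l) (N : ℕ → ℕ) (i : ℕ) :
    0 < traj θ l N i := by
  induction i with
  | zero => exact hl
  | succ i ih => exact hδ.trans_le (le_intensity h hδ _ ih.le)

lemma traj_nonneg (h : CoefBound δ ρ B θ) (hδ : 0 < δ) {l : ℝ} (hl : 0 ≤ l) (N : ℕ → ℕ) (i : ℕ) :
    0 ≤ traj θ l N i := by
  induction i with
  | zero => exact hl
  | succ i ih => exact hδ.le.trans (le_intensity h hδ _ ih)

lemma min_le_traj (h : CoefBound δ ρ B θ) (hδ : 0 < δ) {l : ℝ} (hl : 0 < l) (N : ℕ → ℕ) (i : ℕ) :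
    min δ l ≤ traj θ l N i := by
  cases i with
  | zero => exact min_le_right _ _
  | succ i => exact (min_le_left _ _).trans (le_intensity h hδ _ (traj_pos h hδ hl N i).le)

/-- The recursion contracts by `ρ` in the intensity, whatever the counts, so the arbitrary starting
value is forgotten geometrically. -/
lemma tendsto_traj_sub (h : CoefBound δ ρ B θ) (hδ : 0 < δ) (hρ : ρ < 1) (l l' : ℝ) (N : ℕ → ℕ) :
    Tendsto (fun i => traj θ l N i - traj θ l' N i) atTop (𝓝 0) := by
  have hρ0 := (h.rho_pos hδ).le
  have key : ∀ i, |traj θ l N i - traj θ l' N i| ≤ ρ ^ i * |l - l'| := by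
    intro i
    induction i with
    | zero => simp [traj]
    | succ i ih =>
      refine (abs_intensity_sub_le h hδ _ _ _).trans ?_
      rw [pow_succ']
      nlinarith [mul_le_mul_of_nonneg_left ih hρ0]
  refine squeeze_zero_norm key ?_
  simpa using (tendsto_pow_atTop_nhds_zero_of_lt_one hρ0 hρ).mul_const |l - l'|

/-- A contracting recursion is bounded in mean square by its input. -/
lemma sum_sq_le_of_contraction {x w : ℕ → ℝ} (hρ0 : 0 ≤ ρ) (hρ : ρ < 1) (hx : ∀ i, 0 ≤ x i)
    (hrec : ∀ i, x (i + 1) ≤ ρ * x i + w i) (n : ℕ) :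
    (1 - ρ) * ∑ i ∈ Finset.range n, x i ^ 2
      ≤ x 0 ^ 2 + (∑ i ∈ Finset.range n, w i ^ 2) / (1 - ρ) := by
  have h1 : 0 < 1 - ρ := by linarith
  have step : ∀ i, x (i + 1) ^ 2 ≤ ρ * x i ^ 2 + w i ^ 2 / (1 - ρ) := by
    intro i
    have h2 : x (i + 1) ^ 2 ≤ (ρ * x i + w i) ^ 2 := pow_le_pow_left₀ (hx _) (hrec i) 2
    -- Convexity of the square at `ρ x + (1 - ρ) (w / (1 - ρ))`, with the gap written as an explicit
    -- square.
    have h3 : ρ * x i ^ 2 + w i ^ 2 / (1 - ρ) - (ρ * x i + w i) ^ 2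
        = ρ * ((1 - ρ) * x i - w i) ^ 2 / (1 - ρ) := by
      field_simp
      ring
    have h4 : 0 ≤ ρ * ((1 - ρ) * x i - w i) ^ 2 / (1 - ρ) := by positivity
    linarith
  have : ∀ n, (1 - ρ) * ∑ i ∈ Finset.range n, x i ^ 2 + x n ^ 2
      ≤ x 0 ^ 2 + (∑ i ∈ Finset.range n, w i ^ 2) / (1 - ρ) := by
    intro n
    induction n with
    | zero => simp
    | succ n ih =>
      rw [Finset.sum_range_succ, Finset.sum_range_succ, add_div]
      linarith [step n]
  linarith [this n, sq_nonneg (x n)]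

lemma sum_traj_sq_le (hδ : 0 < δ) (hρ : ρ < 1) {l : ℝ} (hl : 0 ≤ l) {N : ℕ → ℕ} {C : ℝ}
    (hN : ∀ n, ∑ i ∈ Finset.range n, (N i : ℝ) ^ 2 ≤ C * n) :
    ∃ C', ∀ θ, CoefBound δ ρ B θ → ∀ n, ∑ i ∈ Finset.range n, traj θ l N i ^ 2 ≤ C' * n := by
  have h1 : 0 < 1 - ρ := by linarith
  refine ⟨(l ^ 2 + (2 * B ^ 2 * (1 + C)) / (1 - ρ)) / (1 - ρ), fun θ h n => ?_⟩
  rcases Nat.eq_zero_or_pos n with rfl | hn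
  · simp
  have hn1 : (1 : ℝ) ≤ n := by exact_mod_cast hn
  have hB := h.B_pos hδ
  have key := sum_sq_le_of_contraction (h.rho_pos hδ).le hρ
    (x := traj θ l N) (w := fun i => B * (1 + N i)) (traj_nonneg h hδ hl N)
    (fun i => intensity_le h _ (traj_nonneg h hδ hl N i)) n
  have hw : ∑ i ∈ Finset.range n, (B * (1 + (N i : ℝ))) ^ 2 ≤ 2 * B ^ 2 * (1 + C) * n := by
    calc ∑ i ∈ Finset.range n, (B * (1 + (N i : ℝ))) ^ 2
        ≤ ∑ i ∈ Finset.range n, 2 * B ^ 2 * (1 + (N i : ℝ) ^ 2) := by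
          refine Finset.sum_le_sum fun i _ => ?_
          nlinarith [mul_nonneg (sq_nonneg B) (sq_nonneg (1 - (N i : ℝ)))]
      _ = 2 * B ^ 2 * (n + ∑ i ∈ Finset.range n, (N i : ℝ) ^ 2) := by
          rw [← Finset.mul_sum, Finset.sum_add_distrib]; simp
      _ ≤ _ := by
          have := mul_le_mul_of_nonneg_left (hN n) (by positivity : 0 ≤ 2 * B ^ 2)
          nlinarith
  rw [div_mul_eq_mul_div, le_div_iff₀ h1, mul_comm]
  refine key.trans ?_
  have h3 : traj θ l N 0 ^ 2 ≤ l ^ 2 * n := by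
    simpa [traj] using le_mul_of_one_le_right (sq_nonneg l) hn1
  have h4 := div_le_div_of_nonneg_right hw h1.le
  rw [add_mul, div_mul_eq_mul_div]
  linarith

/-- The difference of two trajectories contracts up to an input of size `η (1 + T + N)`, which is
`O(η)` in mean square. Equal thresholds are essential: moving the threshold is not a small
perturbation. The constant does not depend on the parameters. -/
lemma sum_traj_sub_sq_le (hδ : 0 < δ) (hρ : ρ < 1) {l : ℝ} (hl : 0 ≤ l) {N : ℕ → ℕ} {C : ℝ}
    (hN : ∀ n, ∑ i ∈ Finset.range n, (N i : ℝ) ^ 2 ≤ C * n) :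
    ∃ C', ∀ θ θ', CoefBound δ ρ B θ → CoefBound δ ρ B θ' → θ.1 = θ'.1 →
      ∀ η, (∀ i, |θ.2 i - θ'.2 i| ≤ η) → ∀ n,
        ∑ i ∈ Finset.range n, (traj θ l N i - traj θ' l N i) ^ 2 ≤ C' * η ^ 2 * n := by
  have h1 : 0 < 1 - ρ := by linarith
  obtain ⟨C₁, hC₁⟩ := sum_traj_sq_le (B := B) hδ hρ hl hN
  refine ⟨3 * (1 + C₁ + C) / (1 - ρ) / (1 - ρ), fun θ θ' h h' hr η hη n => ?_⟩
  have hη0 : 0 ≤ η := (abs_nonneg _).trans (hη 0)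
  have hT := traj_nonneg h' hδ hl N
  have key := sum_sq_le_of_contraction (h.rho_pos hδ).le hρ
    (x := fun i => |traj θ l N i - traj θ' l N i|) (w := fun i => η * (1 + traj θ' l N i + N i))
    (fun i => abs_nonneg _)
    (fun i => by
      have e1 := abs_intensity_sub_le h hδ (N i) (traj θ l N i) (traj θ' l N i)
      have e2 := abs_intensity_param_sub_le hr hη (N i) (hT i)
      refine (abs_sub_le _ (intensity θ (N i) (traj θ' l N i)) _).trans ?_
      exact add_le_add e1 e2) n
  have hw : ∑ i ∈ Finset.range n, (η * (1 + traj θ' l N i + (N i : ℝ))) ^ 2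
      ≤ 3 * (1 + C₁ + C) * η ^ 2 * n := by
    calc ∑ i ∈ Finset.range n, (η * (1 + traj θ' l N i + (N i : ℝ))) ^ 2
        ≤ ∑ i ∈ Finset.range n, 3 * η ^ 2 * (1 + traj θ' l N i ^ 2 + (N i : ℝ) ^ 2) := by
          refine Finset.sum_le_sum fun i _ => ?_
          have : (1 + traj θ' l N i + (N i : ℝ)) ^ 2
              ≤ 3 * (1 + traj θ' l N i ^ 2 + (N i : ℝ) ^ 2) := by
            nlinarith [sq_nonneg (1 - traj θ' l N i), sq_nonneg (1 - (N i : ℝ)),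
              sq_nonneg (traj θ' l N i - (N i : ℝ))]
          rw [mul_pow]
          nlinarith [mul_le_mul_of_nonneg_left this (sq_nonneg η)]
      _ = 3 * η ^ 2 * (n + ∑ i ∈ Finset.range n, traj θ' l N i ^ 2
            + ∑ i ∈ Finset.range n, (N i : ℝ) ^ 2) := by
          rw [← Finset.mul_sum, Finset.sum_add_distrib, Finset.sum_add_distrib]; simp
      _ ≤ 3 * η ^ 2 * (n + C₁ * n + C * n) := by
          gcongr
          · exact hC₁ θ' h' n
          · exact hN n
      _ = _ := by ring
  simp only [sq_abs] at key
  rw [div_mul_eq_mul_div, div_mul_eq_mul_div, le_div_iff₀ h1, mul_comm]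
  refine key.trans ?_
  have h4 := div_le_div_of_nonneg_right hw h1.le
  have h3 : (traj θ l N 0 - traj θ' l N 0) ^ 2 = 0 := by simp [traj]
  rw [div_mul_eq_mul_div, div_mul_eq_mul_div]
  linarith

lemma tildeLam_succ (l : ℝ) (y : ℕ → ℕ) (θ : Param) (i : ℕ) :
    tildeLam l y θ (i + 1) = traj θ l (fun i => y (i + 1)) i := by
  induction i with
  | zero => rfl
  | succ i ih => rw [tildeLam, ih, traj]

lemma logLik_eq (l : ℝ) (y : ℕ → ℕ) (n : ℕ) (θ : Param) :
    logLik l y n θ = ∑ i ∈ Finset.range n, (-traj θ l (fun i => y (i + 1)) i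
      + (y (i + 1) : ℝ) * Real.log (traj θ l (fun i => y (i + 1)) i)) := by
  have : Finset.Icc 1 n = Finset.Ico 1 (n + 1) := by ext; simp
  rw [logLik, this, Finset.sum_Ico_eq_sum_range]
  simp only [Nat.add_sub_cancel]
  refine Finset.sum_congr rfl fun i _ => ?_
  rw [add_comm 1 i, tildeLam_succ]

end Recursion

/-! ### Inequalities for the compensated Poisson log-likelihood -/

section Hellinger

/-- Writing `log (T / a) = 2 log (√T / √a)` before using `log x ≤ x - 1` produces the cross term
`2√(aT)` and thus a complete square. -/
lemma poisson_ll_sub_le_neg_sq {a T : ℝ} (ha : 0 ≤ a) (hT : 0 < T) :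
    (-T + a * Real.log T) - (-a + a * Real.log a) ≤ -(√T - √a) ^ 2 := by
  have hsT := Real.sq_sqrt hT.le
  rcases ha.eq_or_lt with rfl | ha
  · simp [hT.le]
  have hsa := Real.sq_sqrt ha.le
  have h1 : Real.log T - Real.log a = 2 * Real.log (√T / √a) := by
    rw [Real.log_div (Real.sqrt_pos.2 hT).ne' (Real.sqrt_pos.2 ha).ne', Real.log_sqrt hT.le,
      Real.log_sqrt ha.le]
    ring
  have h2 : Real.log (√T / √a) ≤ √T / √a - 1 :=
    Real.log_le_sub_one_of_pos (div_pos (Real.sqrt_pos.2 hT) (Real.sqrt_pos.2 ha))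
  have h3 : a * (√T / √a) = √T * √a := by
    have := (Real.sqrt_pos.2 ha).ne'
    field_simp
    rw [hsa]
  nlinarith [mul_le_mul_of_nonneg_left h2 ha.le]

/-- The converse estimate, used only for the loss caused by the wrong initial value at `θ₀`. -/
lemma poisson_ll_sub_le_chi_sq {a T : ℝ} (ha : 0 ≤ a) (hT : 0 < T) :
    (-a + a * Real.log a) - (-T + a * Real.log T) ≤ (T - a) ^ 2 / T := by
  rcases ha.eq_or_lt with rfl | ha
  · simp [sq, hT.ne']
  have h2 : Real.log (a / T) ≤ a / T - 1 := Real.log_le_sub_one_of_pos (div_pos ha hT)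
  rw [Real.log_div ha.ne' hT.ne'] at h2
  have h3 : (T - a) ^ 2 / T = T - a + a * (a / T - 1) := by field_simp; ring
  rw [h3]
  nlinarith [mul_le_mul_of_nonneg_left h2 ha.le]

lemma abs_log_sub_log_le {m a b : ℝ} (hm : 0 < m) (ha : m ≤ a) (hb : m ≤ b) :
    |Real.log a - Real.log b| ≤ |a - b| / m := by
  have key : ∀ {a b : ℝ}, m ≤ a → m ≤ b → Real.log a - Real.log b ≤ |a - b| / m := by
    intro a b ha hb
    have ha0 := hm.trans_le ha
    have hb0 := hm.trans_le hb
    have h2 : Real.log (a / b) ≤ a / b - 1 := Real.log_le_sub_one_of_pos (div_pos ha0 hb0)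
    rw [Real.log_div ha0.ne' hb0.ne'] at h2
    have h3 : a / b - 1 = (a - b) / b := by field_simp
    have h4 : (a - b) / b ≤ |a - b| / b := div_le_div_of_nonneg_right (le_abs_self _) hb0.le
    have h5 : |a - b| / b ≤ |a - b| / m := div_le_div_of_nonneg_left (abs_nonneg _) hm hb
    linarith
  rw [abs_le']
  refine ⟨key ha hb, ?_⟩
  rw [neg_sub, abs_sub_comm]
  exact key hb ha

lemma sq_sqrt_sub_sqrt_le {a b : ℝ} (ha : 0 ≤ a) (hb : 0 ≤ b) : (√a - √b) ^ 2 ≤ |a - b| := by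
  have h1 : a - b = (√a - √b) * (√a + √b) := by
    have := Real.sq_sqrt ha
    have := Real.sq_sqrt hb
    nlinarith
  have h2 : |√a - √b| ≤ √a + √b := by
    have := abs_sub (√a) (√b)
    rwa [abs_of_nonneg (Real.sqrt_nonneg a), abs_of_nonneg (Real.sqrt_nonneg b)] at this
  rw [h1, abs_mul, ← sq_abs, sq, abs_of_nonneg (add_nonneg (Real.sqrt_nonneg a) (Real.sqrt_nonneg b))]
  exact mul_le_mul_of_nonneg_left h2 (abs_nonneg _)

end Hellinger

/-! ### The martingale part and its dependence on the parameter -/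

section Noise

variable {δ ρ B : ℝ}

/-- The martingale part of the log-likelihood: the sum of the centred counts `N i - Λ i` times the
logarithms of the intensities computed with `θ`. -/
def noise (θ : Param) (l : ℝ) (N : ℕ → ℕ) (Λ : ℕ → ℝ) (n : ℕ) : ℝ :=
  ∑ i ∈ Finset.range n, ((N i : ℝ) - Λ i) * Real.log (traj θ l N i)

lemma Param.fst_eq_of_dist_lt_one {θ θ' : Param} (h : dist θ θ' < 1) : θ.1 = θ'.1 := by
  have h1 : dist θ.1 θ'.1 < 1 := (le_max_left _ _).trans_lt h
  rw [Nat.dist_eq] at h1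
  have h2 : |(θ.1 : ℤ) - θ'.1| < 1 := by exact_mod_cast h1
  rw [Int.abs_lt_one_iff] at h2
  omega

lemma Param.abs_coef_sub_le_dist (θ θ' : Param) (i : Fin 6) : |θ.2 i - θ'.2 i| ≤ dist θ θ' := by
  have h1 : dist θ.2 θ'.2 ≤ dist θ θ' := le_max_right _ _
  refine le_trans ?_ h1
  rw [dist_eq_norm]
  simpa using PiLp.norm_apply_le (θ.2 - θ'.2) i

/-- The logarithm is Lipschitz because trajectories stay above `min δ l`. The product of `|N - Λ|`
with the trajectory error `e` is split by `2xe ≤ ηx² + e²/η`; as `Σ e² = O(η² n)`, both parts are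
`O(η n)`. -/
lemma abs_noise_sub_le (hδ : 0 < δ) (hρ : ρ < 1) {l : ℝ} (hl : 0 < l) {N : ℕ → ℕ} {Λ : ℕ → ℝ}
    {C : ℝ} (hN : ∀ n, ∑ i ∈ Finset.range n, (N i : ℝ) ^ 2 ≤ C * n)
    (hΛ : ∀ n, ∑ i ∈ Finset.range n, Λ i ^ 2 ≤ C * n) :
    ∃ C', 0 < C' ∧ ∀ θ θ', CoefBound δ ρ B θ → CoefBound δ ρ B θ' → θ.1 = θ'.1 →
      ∀ η, 0 < η → (∀ i, |θ.2 i - θ'.2 i| ≤ η) → ∀ n,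
        |noise θ l N Λ n - noise θ' l N Λ n| ≤ C' * η * n := by
  obtain ⟨C₁, hC₁⟩ := sum_traj_sub_sq_le (B := B) hδ hρ hl.le hN
  have hm : 0 < min δ l := lt_min hδ hl
  set m := min δ l with hmdef
  refine ⟨max ((4 * C + C₁) / (2 * m)) 1, by positivity, fun θ θ' h h' hr η hη0 hη n => ?_⟩
  have hE := hC₁ θ θ' h h' hr η hη n
  have term : ∀ i, |((N i : ℝ) - Λ i) * Real.log (traj θ l N i)
      - ((N i : ℝ) - Λ i) * Real.log (traj θ' l N i)|
      ≤ (2 * η * ((N i : ℝ) ^ 2 + Λ i ^ 2) + (traj θ l N i - traj θ' l N i) ^ 2 / η) / (2 * m) := by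
    intro i
    have h1 := abs_log_sub_log_le hm (min_le_traj h hδ hl N i) (min_le_traj h' hδ hl N i)
    rw [← mul_sub, abs_mul]
    refine (mul_le_mul_of_nonneg_left h1 (abs_nonneg _)).trans ?_
    rw [mul_div_assoc', div_le_div_iff₀ hm (by positivity)]
    set e := |traj θ l N i - traj θ' l N i| with he
    rw [← sq_abs (traj θ l N i - traj θ' l N i), ← he]
    set x := |(N i : ℝ) - Λ i| with hx
    have hx2 : x ^ 2 ≤ 2 * ((N i : ℝ) ^ 2 + Λ i ^ 2) := by
      rw [hx, sq_abs]; nlinarith [sq_nonneg ((N i : ℝ) + Λ i)]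
    have h2 : 2 * (x * e) ≤ η * x ^ 2 + e ^ 2 / η := by
      have h3 : η * x ^ 2 + e ^ 2 / η - 2 * (x * e) = (η * x - e) ^ 2 / η := by
        field_simp; ring
      have : 0 ≤ (η * x - e) ^ 2 / η := by positivity
      linarith
    have h4 : 2 * (x * e) ≤ 2 * η * ((N i : ℝ) ^ 2 + Λ i ^ 2) + e ^ 2 / η := by
      nlinarith [mul_le_mul_of_nonneg_left hx2 hη0.le]
    nlinarith [mul_le_mul_of_nonneg_right h4 hm.le]
  calc |noise θ l N Λ n - noise θ' l N Λ n|
      ≤ ∑ i ∈ Finset.range n, (2 * η * ((N i : ℝ) ^ 2 + Λ i ^ 2)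
          + (traj θ l N i - traj θ' l N i) ^ 2 / η) / (2 * m) := by
        rw [noise, noise, ← Finset.sum_sub_distrib]
        exact (Finset.abs_sum_le_sum_abs _ _).trans (Finset.sum_le_sum fun i _ => term i)
    _ = (2 * η * (∑ i ∈ Finset.range n, (N i : ℝ) ^ 2 + ∑ i ∈ Finset.range n, Λ i ^ 2)
          + (∑ i ∈ Finset.range n, (traj θ l N i - traj θ' l N i) ^ 2) / η) / (2 * m) := by
        rw [← Finset.sum_div, Finset.sum_add_distrib, ← Finset.mul_sum, Finset.sum_add_distrib,
          ← Finset.sum_div]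
    _ ≤ (2 * η * (C * n + C * n) + (C₁ * η ^ 2 * n) / η) / (2 * m) := by
        gcongr
        · exact hN n
        · exact hΛ n
    _ = (4 * C + C₁) / (2 * m) * η * n := by field_simp; ring
    _ ≤ _ := by gcongr; exact le_max_left _ _

lemma tendsto_noise_of_dense (hδ : 0 < δ) (hρ : ρ < 1) {l : ℝ} (hl : 0 < l) {N : ℕ → ℕ}
    {Λ : ℕ → ℝ} {C : ℝ} (hN : ∀ n, ∑ i ∈ Finset.range n, (N i : ℝ) ^ 2 ≤ C * n)
    (hΛ : ∀ n, ∑ i ∈ Finset.range n, Λ i ^ 2 ≤ C * n) {S Q : Set Param}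
    (hS : ∀ θ ∈ S, CoefBound δ ρ B θ) (hQS : Q ⊆ S) (hSQ : S ⊆ closure Q)
    (hQ : ∀ θ ∈ Q, Tendsto (fun n : ℕ => noise θ l N Λ n / n) atTop (𝓝 0)) :
    ∀ θ ∈ S, Tendsto (fun n : ℕ => noise θ l N Λ n / n) atTop (𝓝 0) := by
  obtain ⟨C', hC', key⟩ := abs_noise_sub_le (B := B) hδ hρ hl hN hΛ
  intro θ hθ
  rw [Metric.tendsto_atTop]
  intro ε hε
  have hη : 0 < min 1 (ε / (2 * C')) := by positivity
  obtain ⟨q, hq, hd⟩ := Metric.mem_closure_iff.1 (hSQ hθ) _ hη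
  obtain ⟨n₀, hn₀⟩ := Metric.tendsto_atTop.1 (hQ q hq) (ε / 2) (by positivity)
  refine ⟨max n₀ 1, fun n hn => ?_⟩
  have hn1 : (0 : ℝ) < n := by exact_mod_cast (le_max_right n₀ 1).trans hn
  have h1 := hn₀ n ((le_max_left _ _).trans hn)
  have h2 := key θ q (hS θ hθ) (hS q (hQS hq))
    (Param.fst_eq_of_dist_lt_one (hd.trans_le (min_le_left _ _))) (ε / (2 * C')) (by positivity)
    (fun i => (Param.abs_coef_sub_le_dist θ q i).trans (hd.le.trans (min_le_right _ _))) n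
  rw [Real.dist_eq, sub_zero] at h1 ⊢
  have h3 : C' * (ε / (2 * C')) * n = ε / 2 * n := by field_simp
  rw [h3] at h2
  rw [abs_div, abs_of_pos hn1, div_lt_iff₀ hn1] at h1 ⊢
  have := abs_sub_abs_le_abs_sub (noise θ l N Λ n) (noise q l N Λ n)
  linarith

end Noise

/-! ### Identification of the recursion from small average errors -/

section Identification

variable {δ ρ B : ℝ}

/-- If the averages of a nonnegative sequence `d` vanish along `φ` and `p` has positive lower
frequency, then `d` is small at two consecutive places following an occurrence of `p`. -/
lemma exists_lt_of_frequency {d : ℕ → ℝ} (hd : ∀ i, 0 ≤ d i) {φ : ℕ → ℕ}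
    (hφ : Tendsto φ atTop atTop)
    (havg : Tendsto (fun k => (∑ i ∈ Finset.range (φ k), d i) / φ k) atTop (𝓝 0))
    {p : ℕ → Prop} [DecidablePred p] {c : ℝ} (hc : 0 < c)
    (hp : ∀ᶠ n : ℕ in atTop, c * n ≤ ((Finset.range n).filter p).card) {ε : ℝ} (hε : 0 < ε) :
    ∃ i, p i ∧ d (i + 1) < ε ∧ d (i + 2) < ε := by
  by_contra! hcon
  have hle : ∀ i, p i → ε ≤ d (i + 1) + d (i + 2) := by
    intro i hi
    by_cases h : d (i + 1) < ε
    · linarith [hcon i hi h, hd (i + 1)]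
    · linarith [hd (i + 2)]
  have hsum : ∀ m, ε * ((Finset.range m).filter p).card
      ≤ 2 * ∑ i ∈ Finset.range (m + 2), d i := by
    intro m
    calc ε * ((Finset.range m).filter p).card
        = ∑ i ∈ (Finset.range m).filter p, ε := by simp [mul_comm]
      _ ≤ ∑ i ∈ (Finset.range m).filter p, (d (i + 1) + d (i + 2)) :=
          Finset.sum_le_sum fun i hi => hle i (Finset.mem_filter.1 hi).2
      _ ≤ ∑ i ∈ Finset.range m, (d (i + 1) + d (i + 2)) :=
          Finset.sum_le_sum_of_subset_of_nonneg (Finset.filter_subset _ _)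
            fun i _ _ => add_nonneg (hd _) (hd _)
      _ = ∑ i ∈ Finset.range m, d (i + 1) + ∑ i ∈ Finset.range m, d (i + 2) :=
          Finset.sum_add_distrib
      _ ≤ _ := by
          have h1 := Finset.sum_range_succ' d m
          have h2 := Finset.sum_range_succ d (m + 1)
          have h3 := Finset.sum_range_succ' d (m + 1)
          have h4 := Finset.sum_range_succ' (fun i => d (i + 1)) m
          linarith [hd 0, hd (m + 1), hd 1]
  -- With `φ k = m + 2`, the frequency bound gives `εcm ≤ 2 Σ d`, while an average below `εc/4`
  -- gives `2 Σ d < εc(m + 2)/2`. These conflict once `m ≥ 2`.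
  have hev := (hφ.eventually ((tendsto_sub_atTop_nat 2).eventually hp)).and
    ((hφ.eventually (eventually_ge_atTop 4)).and
      (havg.eventually (gt_mem_nhds (show (0 : ℝ) < ε * c / 4 by positivity))))
  obtain ⟨k, h1, h2, h3⟩ := hev.exists
  obtain ⟨m, hm⟩ : ∃ m, φ k = m + 2 := ⟨φ k - 2, by omega⟩
  rw [hm] at h1 h2 h3
  rw [Nat.add_sub_cancel] at h1
  have hm2 : (2 : ℝ) ≤ m := by exact_mod_cast (by omega : 2 ≤ m)
  rw [div_lt_iff₀ (by positivity)] at h3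
  have h4 := hsum m
  have h5 := mul_le_mul_of_nonneg_left h1 hε.le
  have hεc : 0 < ε * c := by positivity
  push_cast at h3
  nlinarith

lemma abs_sub_le_of_sq_sqrt_sub_lt {a T s H : ℝ} (ha : 0 ≤ a) (hT : 0 ≤ T) (hs : 0 ≤ s)
    (hs1 : s ≤ 1) (haH : a ≤ H) (h : (√T - √a) ^ 2 < s ^ 2) : |T - a| ≤ s * (1 + 2 * √H) := by
  have h1 : T - a = (√T - √a) * (√T - √a + 2 * √a) := by
    have := Real.sq_sqrt ha
    have := Real.sq_sqrt hT
    nlinarith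
  have h2 : |√T - √a| ≤ s := abs_le_of_sq_le_sq h.le hs
  have h3 : |√T - √a + 2 * √a| ≤ 1 + 2 * √H := by
    refine (abs_add_le _ _).trans ?_
    rw [abs_of_nonneg (show 0 ≤ 2 * √a by positivity)]
    have := Real.sqrt_le_sqrt haH
    linarith
  rw [h1, abs_mul]
  exact mul_le_mul h2 h3 (abs_nonneg _) hs

lemma exists_intensity_eq_affine (θ : Param) (y : ℕ) :
    ∃ A M, ∀ l, intensity θ y l = A + M * l := by
  unfold intensity
  split_ifs
  · exact ⟨Param.d₁ θ + Param.b₁ θ * y, Param.a₁ θ, fun l => by ring⟩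
  · exact ⟨Param.d₂ θ + Param.b₂ θ * y, Param.a₂ θ, fun l => by ring⟩

/-- If the intensities computed with `θ` and with `θ₀` become close at two consecutive places, the
first of which carries the count `y` and an intensity in `[lo, hi]`, then the two recursions agree
at `y` and some `l ∈ [lo, hi]`. -/
lemma exists_intensity_eq {θ θ₀ : Param} (hθ : CoefBound δ ρ B θ) (hθ₀ : CoefBound δ ρ B θ₀)
    (hδ : 0 < δ) (hρ : ρ < 1) {l₁ l₀ : ℝ} (hl₁ : 0 ≤ l₁) (hl₀ : 0 ≤ l₀) {N : ℕ → ℕ} {y : ℕ}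
    {lo hi : ℝ} {p : ℕ → Prop} (hpy : ∀ i, p i → N (i + 1) = y)
    (hplo : ∀ i, p i → lo ≤ traj θ₀ l₀ N (i + 1)) (hphi : ∀ i, p i → traj θ₀ l₀ N (i + 1) ≤ hi)
    (hclose : ∀ ε, 0 < ε → ∃ i, p i ∧ (√(traj θ l₁ N (i + 1)) - √(traj θ₀ l₀ N (i + 1))) ^ 2 < ε ∧
      (√(traj θ l₁ N (i + 2)) - √(traj θ₀ l₀ N (i + 2))) ^ 2 < ε) :
    ∃ l, lo ≤ l ∧ l ≤ hi ∧ intensity θ y l = intensity θ₀ y l := by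
  by_contra! hcon
  obtain ⟨A, M, hAM⟩ := exists_intensity_eq_affine θ y
  obtain ⟨A₀, M₀, hAM₀⟩ := exists_intensity_eq_affine θ₀ y
  have hne : (Set.Icc lo hi).Nonempty := by
    obtain ⟨i, hi, -⟩ := hclose 1 one_pos
    exact ⟨_, hplo i hi, hphi i hi⟩
  have hcont : Continuous fun l => |intensity θ y l - intensity θ₀ y l| := by
    simp only [hAM, hAM₀]
    fun_prop
  obtain ⟨z, hz, hzmin⟩ := isCompact_Icc.exists_isMinOn hne hcont.continuousOn
  set c := |intensity θ y z - intensity θ₀ y z| with hcdef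
  have hc : 0 < c := abs_pos.2 (sub_ne_zero.2 (hcon z hz.1 hz.2))
  have hT := traj_nonneg hθ hδ hl₁ N
  have hΛ := traj_nonneg hθ₀ hδ hl₀ N
  -- `H` bounds the true intensity at both places, and `s` is small enough that square roots within
  -- `s` mean intensities within `c/4`. The two errors then add up to at most `c/2`, against the
  -- minimal gap `c`.
  set H := max hi (ρ * hi + B * (1 + y)) with hH
  set s := min 1 (c / (4 * (1 + 2 * √H))) with hs
  have hs0 : 0 < s := by positivity
  have hsc : s * (1 + 2 * √H) ≤ c / 4 := by
    calc s * (1 + 2 * √H) ≤ c / (4 * (1 + 2 * √H)) * (1 + 2 * √H) := by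
          gcongr; exact min_le_right _ _
      _ = c / 4 := by field_simp
  obtain ⟨i, hpi, h1, h2⟩ := hclose (s ^ 2) (by positivity)
  have hΛ1 : traj θ₀ l₀ N (i + 1) ≤ H := (hphi i hpi).trans (le_max_left _ _)
  have hΛ2 : traj θ₀ l₀ N (i + 2) ≤ H := by
    refine le_trans ?_ (le_max_right _ _)
    rw [← hpy i hpi]
    refine (intensity_le hθ₀ (N (i + 1)) (hΛ (i + 1))).trans ?_
    have := mul_le_mul_of_nonneg_left (hphi i hpi) (hθ₀.rho_pos hδ).le
    linarith
  have e1 := abs_sub_le_of_sq_sqrt_sub_lt (hΛ _) (hT _) hs0.le (min_le_left _ _) hΛ1 h1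
  have e2 := abs_sub_le_of_sq_sqrt_sub_lt (hΛ _) (hT _) hs0.le (min_le_left _ _) hΛ2 h2
  have e3 : |intensity θ y (traj θ₀ l₀ N (i + 1)) - intensity θ y (traj θ l₁ N (i + 1))|
      ≤ c / 4 := by
    refine (abs_intensity_sub_le hθ hδ y _ _).trans ?_
    rw [abs_sub_comm]
    have := mul_le_mul_of_nonneg_right hρ.le
      (abs_nonneg (traj θ l₁ N (i + 1) - traj θ₀ l₀ N (i + 1)))
    linarith
  have e4 : |intensity θ y (traj θ l₁ N (i + 1)) - intensity θ₀ y (traj θ₀ l₀ N (i + 1))|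
      ≤ c / 4 := by
    rw [← hpy i hpi]
    exact e2.trans hsc
  have e5 : c ≤ |intensity θ y (traj θ₀ l₀ N (i + 1)) - intensity θ₀ y (traj θ₀ l₀ N (i + 1))| :=
    hzmin ⟨hplo i hpi, hphi i hpi⟩
  have e6 := abs_sub_le (intensity θ y (traj θ₀ l₀ N (i + 1)))
    (intensity θ y (traj θ l₁ N (i + 1))) (intensity θ₀ y (traj θ₀ l₀ N (i + 1)))
  linarith

lemma intensity_eq_of_eq_of_eq {θ θ₀ : Param} {y : ℕ} {l l' : ℝ} (hll' : l ≠ l')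
    (h : intensity θ y l = intensity θ₀ y l) (h' : intensity θ y l' = intensity θ₀ y l') (x : ℝ) :
    intensity θ y x = intensity θ₀ y x := by
  obtain ⟨A, M, hAM⟩ := exists_intensity_eq_affine θ y
  obtain ⟨A₀, M₀, hAM₀⟩ := exists_intensity_eq_affine θ₀ y
  simp only [hAM, hAM₀] at *
  have hM : M = M₀ := by
    have : (M - M₀) * (l - l') = 0 := by linarith
    rcases mul_eq_zero.1 this with h1 | h1
    · linarith
    · exact absurd (sub_eq_zero.1 h1) hll'
  subst hM
  linarith

/-- Identification: if, along a subsequence, the intensities computed with `θ` are close on average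
to those computed with `θ₀`, and if all pairs of consecutive counts occur with positive lower
frequency at bounded intensities, then `θ` and `θ₀` define the same recursion. -/
lemma intensity_eq_of_tendsto_avg {θ θ₀ : Param} (hθ : CoefBound δ ρ B θ)
    (hθ₀ : CoefBound δ ρ B θ₀) (hδ : 0 < δ) (hρ : ρ < 1) {l₁ l₀ : ℝ} (hl₁ : 0 ≤ l₁) (hl₀ : 0 ≤ l₀)
    {N : ℕ → ℕ} {φ : ℕ → ℕ} (hφ : Tendsto φ atTop atTop)
    (havg : Tendsto (fun k => (∑ i ∈ Finset.range (φ k),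
      (√(traj θ l₁ N i) - √(traj θ₀ l₀ N i)) ^ 2) / φ k) atTop (𝓝 0)) {K : ℝ}
    (hpat : ∀ y' y : ℕ, ∃ c : ℝ, 0 < c ∧ ∀ᶠ n : ℕ in atTop, c * n ≤ ((Finset.range n).filter
      (fun i => traj θ₀ l₀ N i ≤ K ∧ N i = y' ∧ N (i + 1) = y)).card) (y : ℕ) (l : ℝ) :
    intensity θ y l = intensity θ₀ y l := by
  have hΛ := traj_nonneg hθ₀ hδ hl₀ N
  have root : ∀ y' : ℕ, ∃ l, δ * y' ≤ l ∧ l ≤ ρ * K + B * (1 + y') ∧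
      intensity θ y l = intensity θ₀ y l := by
    intro y'
    obtain ⟨c, hc, hfreq⟩ := hpat y' y
    refine exists_intensity_eq (p := fun i => traj θ₀ l₀ N i ≤ K ∧ N i = y' ∧ N (i + 1) = y)
      hθ hθ₀ hδ hρ hl₁ hl₀ (fun i hi => hi.2.2) (fun i hi => ?_) (fun i hi => ?_) fun ε hε =>
      exists_lt_of_frequency (fun i => sq_nonneg _) hφ havg hc hfreq hε
    · rw [← hi.2.1]
      exact mul_count_le_intensity hθ₀ hδ _ (hΛ i)
    · rw [← hi.2.1]
      refine (intensity_le hθ₀ _ (hΛ i)).trans ?_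
      have := mul_le_mul_of_nonneg_left hi.1 (hθ₀.rho_pos hδ).le
      linarith
  -- A large preceding count forces the next intensity above `δ y'`, beyond every intensity that can
  -- follow the count `0`, so the two points of agreement differ.
  obtain ⟨y', hy'⟩ := exists_nat_gt ((ρ * K + B * (1 + (0 : ℕ))) / δ)
  rw [div_lt_iff₀' hδ] at hy'
  obtain ⟨a, -, ha, haeq⟩ := root 0
  obtain ⟨b, hb, -, hbeq⟩ := root y'
  exact intensity_eq_of_eq_of_eq (by linarith : a < b).ne haeq hbeq l

end Identification

/-! ### Deterministic consistency argument -/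

section Consistency

variable {δ ρ B : ℝ}

/-- Splitting each count as `Λ + (N - Λ)` separates compensated likelihood from noise. The
likelihood at `θ₀` starts from `l₁` and not from the true `l₀`, whence the chi-square term. -/
lemma sum_hellinger_le_of_isMLE {S : Set Param} (hS : ∀ θ ∈ S, CoefBound δ ρ B θ) (hδ : 0 < δ)
    {θ₀ θ' : Param} (hθ₀ : θ₀ ∈ S) {l₁ l₀ : ℝ} (hl₁ : 0 < l₁) (hl₀ : 0 ≤ l₀) {y : ℕ → ℕ} {n : ℕ}
    {N : ℕ → ℕ} (hN : N = fun i => y (i + 1)) (hmle : IsMLE S l₁ y n θ') :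
    ∑ i ∈ Finset.range n, (√(traj θ' l₁ N i) - √(traj θ₀ l₀ N i)) ^ 2
      ≤ ∑ i ∈ Finset.range n, (traj θ₀ l₁ N i - traj θ₀ l₀ N i) ^ 2 / traj θ₀ l₁ N i
        + noise θ' l₁ N (traj θ₀ l₀ N) n - noise θ₀ l₁ N (traj θ₀ l₀ N) n := by
  have h := hmle.2 θ₀ hθ₀
  rw [logLik_eq, logLik_eq, ← hN] at h
  have hy : ∀ i, y (i + 1) = N i := fun i => by rw [hN]
  simp only [hy] at h
  have hsub : 0 ≤ ∑ i ∈ Finset.range n, ((-traj θ' l₁ N i + N i * Real.log (traj θ' l₁ N i))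
      - (-traj θ₀ l₁ N i + N i * Real.log (traj θ₀ l₁ N i))) := by
    rw [Finset.sum_sub_distrib]; linarith
  have hterm : ∀ i, (√(traj θ' l₁ N i) - √(traj θ₀ l₀ N i)) ^ 2
      + ((-traj θ' l₁ N i + N i * Real.log (traj θ' l₁ N i))
        - (-traj θ₀ l₁ N i + N i * Real.log (traj θ₀ l₁ N i)))
      ≤ (traj θ₀ l₁ N i - traj θ₀ l₀ N i) ^ 2 / traj θ₀ l₁ N i
        + (((N i : ℝ) - traj θ₀ l₀ N i) * Real.log (traj θ' l₁ N i)
          - ((N i : ℝ) - traj θ₀ l₀ N i) * Real.log (traj θ₀ l₁ N i)) := by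
    intro i
    have h1 := poisson_ll_sub_le_neg_sq (traj_nonneg (hS θ₀ hθ₀) hδ hl₀ N i)
      (traj_pos (hS θ' hmle.1) hδ hl₁ N i)
    have h2 := poisson_ll_sub_le_chi_sq (traj_nonneg (hS θ₀ hθ₀) hδ hl₀ N i)
      (traj_pos (hS θ₀ hθ₀) hδ hl₁ N i)
    linarith
  have hsum := Finset.sum_le_sum fun i (_ : i ∈ Finset.range n) => hterm i
  simp only [Finset.sum_add_distrib] at hsum
  rw [Finset.sum_sub_distrib
    (f := fun i => ((N i : ℝ) - traj θ₀ l₀ N i) * Real.log (traj θ' l₁ N i))] at hsum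
  unfold noise
  linarith

lemma tendsto_avg_chi_sq {θ₀ : Param} (h : CoefBound δ ρ B θ₀) (hδ : 0 < δ) (hρ : ρ < 1)
    {l₁ : ℝ} (l₀ : ℝ) (hl₁ : 0 < l₁) (N : ℕ → ℕ) :
    Tendsto (fun n : ℕ => (∑ i ∈ Finset.range n,
      (traj θ₀ l₁ N i - traj θ₀ l₀ N i) ^ 2 / traj θ₀ l₁ N i) / n) atTop (𝓝 0) := by
  have hm : 0 < min δ l₁ := lt_min hδ hl₁
  have h1 : Tendsto (fun i => (traj θ₀ l₁ N i - traj θ₀ l₀ N i) ^ 2 / traj θ₀ l₁ N i)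
      atTop (𝓝 0) := by
    have h2 := ((tendsto_traj_sub h hδ hρ l₁ l₀ N).pow 2).div_const (min δ l₁)
    simp only [ne_eq, OfNat.ofNat_ne_zero, not_false_eq_true, zero_pow, zero_div] at h2
    refine squeeze_zero (fun i => ?_) (fun i => ?_) h2
    · have := traj_pos h hδ hl₁ N i
      positivity
    · exact div_le_div_of_nonneg_left (sq_nonneg _) hm (min_le_traj h hδ hl₁ N i)
  refine h1.cesaro.congr fun n => ?_
  rw [div_eq_inv_mul]

/-- The deterministic core of the consistency theorem. -/
theorem tendsto_infDist_of_noise {S : Set Param} (hScpt : IsCompact S)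
    (hS : ∀ θ ∈ S, CoefBound δ ρ B θ) (hδ : 0 < δ) (hρ : ρ < 1) {θ₀ : Param} (hθ₀ : θ₀ ∈ S)
    {l₁ l₀ : ℝ} (hl₁ : 0 < l₁) (hl₀ : 0 ≤ l₀) {y N : ℕ → ℕ} (hNy : N = fun i => y (i + 1))
    {C : ℝ} (hN : ∀ n, ∑ i ∈ Finset.range n, (N i : ℝ) ^ 2 ≤ C * n)
    (hΛ : ∀ n, ∑ i ∈ Finset.range n, traj θ₀ l₀ N i ^ 2 ≤ C * n)
    (hnoise : ∀ θ ∈ S,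
      Tendsto (fun n : ℕ => noise θ l₁ N (traj θ₀ l₀ N) n / n) atTop (𝓝 0)) {K : ℝ}
    (hpat : ∀ y' y : ℕ, ∃ c : ℝ, 0 < c ∧ ∀ᶠ n : ℕ in atTop, c * n ≤ ((Finset.range n).filter
      (fun i => traj θ₀ l₀ N i ≤ K ∧ N i = y' ∧ N (i + 1) = y)).card)
    {θhat : ℕ → Param} (hhat : ∀ n, 1 ≤ n → IsMLE S l₁ y n (θhat n)) :
    Tendsto (fun n => Metric.infDist (θhat n) (sameModel S θ₀)) atTop (𝓝 0) := by
  by_contra hcon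
  rw [Metric.tendsto_atTop] at hcon
  push Not at hcon
  obtain ⟨ε, hε, hbad⟩ := hcon
  have hfreq : ∃ᶠ n in atTop, 1 ≤ n ∧ ε ≤ Metric.infDist (θhat n) (sameModel S θ₀) := by
    rw [Filter.frequently_atTop]
    intro n₀
    obtain ⟨n, hn, h⟩ := hbad (max n₀ 1)
    refine ⟨n, (le_max_left _ _).trans hn, (le_max_right _ _).trans hn, ?_⟩
    rwa [Real.dist_eq, sub_zero, abs_of_nonneg Metric.infDist_nonneg] at h
  obtain ⟨ψ, hψ, hψp⟩ := extraction_of_frequently_atTop hfreq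
  obtain ⟨θ, hθS, χ, hχ, hlim⟩ := hScpt.tendsto_subseq
    (x := fun k => θhat (ψ k)) fun k => (hhat _ (hψp k).1).1
  set φ : ℕ → ℕ := ψ ∘ χ with hφdef
  have hφ : Tendsto φ atTop atTop := (hψ.comp hχ).tendsto_atTop
  have hφ1 : ∀ k, 1 ≤ φ k := fun k => (hψp (χ k)).1
  have hlim' : Tendsto (fun k => θhat (φ k)) atTop (𝓝 θ) := hlim
  obtain ⟨C₁, hC₁, hnoise_sub⟩ := abs_noise_sub_le (B := B) hδ hρ hl₁ hN hΛ
  obtain ⟨C₂, hC₂⟩ := sum_traj_sub_sq_le (B := B) hδ hρ hl₁.le hN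
  have havg : Tendsto (fun k => (∑ i ∈ Finset.range (φ k),
      (√(traj θ l₁ N i) - √(traj θ₀ l₀ N i)) ^ 2) / φ k) atTop (𝓝 0) := by
    set r : ℕ → ℝ := fun n => (∑ i ∈ Finset.range n,
      (traj θ₀ l₁ N i - traj θ₀ l₀ N i) ^ 2 / traj θ₀ l₁ N i) / n
      + noise θ l₁ N (traj θ₀ l₀ N) n / n - noise θ₀ l₁ N (traj θ₀ l₀ N) n / n with hr
    have hr0 : Tendsto r atTop (𝓝 0) := by
      simpa using ((tendsto_avg_chi_sq (hS θ₀ hθ₀) hδ hρ l₀ hl₁ N).add (hnoise θ hθS)).sub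
        (hnoise θ₀ hθ₀)
    -- The limit parameter is compared with the nearby estimate: `2r` comes from the likelihood
    -- inequality, `2C₁η` from moving the noise, and the remaining terms from moving the trajectory.
    -- Requiring `η < 1` makes the thresholds equal.
    have hbound : ∀ η, 0 < η → η < 1 → ∀ k, dist (θhat (φ k)) θ < η →
        (∑ i ∈ Finset.range (φ k), (√(traj θ l₁ N i) - √(traj θ₀ l₀ N i)) ^ 2) / φ k
          ≤ 2 * r (φ k) + (2 * C₁ + 1 + |C₂|) * η := by
      intro η hη hη1 k hd
      set n := φ k with hn
      have hn0 : (0 : ℝ) < n := by exact_mod_cast hφ1 k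
      have hmle := hhat n (hφ1 k)
      have hr1 := Param.fst_eq_of_dist_lt_one (hd.trans hη1)
      have hη' : ∀ i, |(θhat n).2 i - θ.2 i| ≤ η := fun i =>
        (Param.abs_coef_sub_le_dist _ _ i).trans hd.le
      have h1 := sum_hellinger_le_of_isMLE hS hδ hθ₀ hl₁ hl₀ hNy hmle
      have h2 := le_of_abs_le
        (hnoise_sub _ _ (hS _ hmle.1) (hS θ hθS) hr1 η hη hη' n)
      have h3 := hC₂ _ _ (hS _ hmle.1) (hS θ hθS) hr1 η hη' n
      have h4 : ∑ i ∈ Finset.range n, (√(traj θ l₁ N i) - √(traj θ₀ l₀ N i)) ^ 2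
          ≤ ∑ i ∈ Finset.range n, (2 * (√(traj (θhat n) l₁ N i) - √(traj θ₀ l₀ N i)) ^ 2
            + (η + (traj (θhat n) l₁ N i - traj θ l₁ N i) ^ 2 / η)) := by
        refine Finset.sum_le_sum fun i _ => ?_
        -- `(√T - √Λ)² ≤ 2(√T' - √Λ)² + 2|T' - T|`, and the last term is at most `η + (T' - T)²/η`,
        -- whose average is `O(η)`.
        have e1 := sq_sqrt_sub_sqrt_le (traj_nonneg (hS _ hmle.1) hδ hl₁.le N i)
          (traj_nonneg (hS θ hθS) hδ hl₁.le N i)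
        have e2 : 2 * |traj (θhat n) l₁ N i - traj θ l₁ N i|
            ≤ η + (traj (θhat n) l₁ N i - traj θ l₁ N i) ^ 2 / η := by
          rw [← sq_abs (traj (θhat n) l₁ N i - traj θ l₁ N i)]
          set e := |traj (θhat n) l₁ N i - traj θ l₁ N i|
          have h3 : η + e ^ 2 / η - 2 * e = (η - e) ^ 2 / η := by field_simp; ring
          have : 0 ≤ (η - e) ^ 2 / η := by positivity
          linarith
        nlinarith [sq_nonneg ((√(traj (θhat n) l₁ N i) - √(traj θ₀ l₀ N i))
          + (√(traj (θhat n) l₁ N i) - √(traj θ l₁ N i)))]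
      rw [Finset.sum_add_distrib, Finset.sum_add_distrib, ← Finset.mul_sum, ← Finset.sum_div,
        Finset.sum_const, Finset.card_range, nsmul_eq_mul] at h4
      have h5 : (∑ i ∈ Finset.range n, (traj (θhat n) l₁ N i - traj θ l₁ N i) ^ 2) / η
          ≤ |C₂| * η * n := by
        rw [div_le_iff₀ hη]
        refine h3.trans ?_
        have := le_abs_self C₂
        have h0 : 0 ≤ η ^ 2 * n := by positivity
        nlinarith [mul_le_mul_of_nonneg_right this h0]
      rw [div_le_iff₀ hn0]
      have h6 : r n * n = (∑ i ∈ Finset.range n,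
          (traj θ₀ l₁ N i - traj θ₀ l₀ N i) ^ 2 / traj θ₀ l₁ N i)
          + noise θ l₁ N (traj θ₀ l₀ N) n - noise θ₀ l₁ N (traj θ₀ l₀ N) n := by
        rw [hr]; field_simp
      nlinarith
    rw [Metric.tendsto_atTop]
    intro e he
    have hCpos : 0 < 2 * C₁ + 1 + |C₂| := by positivity
    have hη : 0 < min (1 / 2) (e / (2 * (2 * C₁ + 1 + |C₂|))) := by positivity
    obtain ⟨k₁, hk₁⟩ := Metric.tendsto_atTop.1 hlim' _ hη
    obtain ⟨k₂, hk₂⟩ := Metric.tendsto_atTop.1 (hr0.comp hφ) (e / 4) (by positivity)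
    refine ⟨max k₁ k₂, fun k hk => ?_⟩
    have h1 := hbound _ hη (by
      refine (min_le_left _ _).trans_lt (by norm_num)) k (hk₁ k ((le_max_left _ _).trans hk))
    have h2 := hk₂ k ((le_max_right _ _).trans hk)
    rw [Real.dist_eq, sub_zero] at h2 ⊢
    rw [abs_of_nonneg (div_nonneg (Finset.sum_nonneg fun i _ => sq_nonneg _) (Nat.cast_nonneg _))]
    have h3 : (2 * C₁ + 1 + |C₂|) * min (1 / 2) (e / (2 * (2 * C₁ + 1 + |C₂|))) ≤ e / 2 := by
      calc _ ≤ (2 * C₁ + 1 + |C₂|) * (e / (2 * (2 * C₁ + 1 + |C₂|))) := by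
            gcongr; exact min_le_right _ _
        _ = e / 2 := by field_simp
    have h4 := (le_abs_self _).trans_lt h2
    simp only [Function.comp_apply] at h4
    linarith
  have hmem : θ ∈ sameModel S θ₀ := ⟨hθS, fun y l _ =>
    intensity_eq_of_tendsto_avg (hS θ hθS) (hS θ₀ hθ₀) hδ hρ hl₁.le hl₀ hφ havg hpat y l⟩
  have h1 : Tendsto (fun k => Metric.infDist (θhat (φ k)) (sameModel S θ₀)) atTop
      (𝓝 (Metric.infDist θ (sameModel S θ₀))) :=
    ((Metric.continuous_infDist_pt _).tendsto θ).comp hlim'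
  rw [Metric.infDist_zero_of_mem hmem] at h1
  have h2 : ε ≤ 0 := ge_of_tendsto' h1 fun k => (hψp (χ k)).2
  linarith

/-- Large counts determine the upper regime. A threshold below `r₀` would make both regimes of `θ₀`
agree at `y = r₀`. So the counts `0` and `1` lie in both lower regimes and determine the lower
coefficients, and a threshold above `r₀` would force agreement at `r₀ + 1`. -/
lemma sameModel_eq_singleton {rstar : ℕ} {D : Set Coef} {θ₀ : Param}
    (hθ₀ : θ₀ ∈ paramSpace rstar D) (hnd : Nondegenerate rstar θ₀) :
    sameModel (paramSpace rstar D) θ₀ = {θ₀} := by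
  refine Set.Subset.antisymm ?_ (Set.singleton_subset_iff.2 ⟨hθ₀, fun _ _ _ => rfl⟩)
  rintro θ ⟨hθ, h⟩
  obtain ⟨hr1, hnd⟩ := hnd
  have key : ∀ y : ℕ, intensity θ y 1 = intensity θ₀ y 1 ∧ intensity θ y 2 = intensity θ₀ y 2 :=
    fun y => ⟨h y 1 one_pos, h y 2 two_pos⟩
  unfold intensity at key
  have up : ∀ y : ℕ, θ.1 < y → θ₀.1 < y → Param.a₂ θ = Param.a₂ θ₀ ∧
      Param.d₂ θ + Param.b₂ θ * y = Param.d₂ θ₀ + Param.b₂ θ₀ * y := by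
    intro y h1 h2
    have := key y
    rw [if_neg h1.not_ge, if_neg h1.not_ge, if_neg h2.not_ge, if_neg h2.not_ge] at this
    constructor <;> linarith [this.1, this.2]
  have low : ∀ y : ℕ, y ≤ θ.1 → y ≤ θ₀.1 → Param.a₁ θ = Param.a₁ θ₀ ∧
      Param.d₁ θ + Param.b₁ θ * y = Param.d₁ θ₀ + Param.b₁ θ₀ * y := by
    intro y h1 h2
    have := key y
    rw [if_pos h1, if_pos h1, if_pos h2, if_pos h2] at this
    constructor <;> linarith [this.1, this.2]
  have hup : Param.a₂ θ = Param.a₂ θ₀ ∧ Param.d₂ θ = Param.d₂ θ₀ ∧ Param.b₂ θ = Param.b₂ θ₀ := by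
    have h1 := up (θ.1 + θ₀.1 + 1) (by omega) (by omega)
    have h2 := up (θ.1 + θ₀.1 + 2) (by omega) (by omega)
    push_cast at h1 h2
    have hb : Param.b₂ θ = Param.b₂ θ₀ := by linarith [h1.2, h2.2]
    refine ⟨h1.1, ?_, hb⟩
    have := h1.2
    rw [hb] at this
    linarith
  have hrle : θ₀.1 ≤ θ.1 := by
    by_contra! hlt
    have := key θ₀.1
    rw [if_neg hlt.not_ge, if_neg hlt.not_ge, if_pos le_rfl, if_pos le_rfl, hup.1, hup.2.1,
      hup.2.2] at this
    exact (hnd (by linarith [this.1, this.2])).1 (by linarith [this.1, this.2])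
  have hlow : Param.a₁ θ = Param.a₁ θ₀ ∧ Param.d₁ θ = Param.d₁ θ₀ ∧ Param.b₁ θ = Param.b₁ θ₀ := by
    have h1 := low 0 (by omega) (by omega)
    have h2 := low 1 (by omega) (by omega)
    push_cast at h1 h2
    have hd : Param.d₁ θ = Param.d₁ θ₀ := by linarith [h1.2]
    exact ⟨h1.1, hd, by linarith [h2.2]⟩
  have hr : θ.1 = θ₀.1 := by
    refine le_antisymm ?_ hrle
    by_contra! hlt
    have := key (θ₀.1 + 1)
    have hle : θ₀.1 + 1 ≤ θ.1 := hlt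
    rw [if_pos hle, if_pos hle, if_neg (Nat.not_succ_le_self _),
      if_neg (Nat.not_succ_le_self _), hlow.1, hlow.2.1, hlow.2.2] at this
    push_cast at this
    exact (hnd (by linarith [this.1, this.2])).2 (hlt.trans_le hθ.1) (by linarith [this.1, this.2])
  refine Prod.ext hr ?_
  ext i
  fin_cases i
  exacts [hlow.2.1, hlow.1, hlow.2.2, hup.2.1, hup.1, hup.2.2]

end Consistency

/-! ### A strong law for square-integrable martingale differences -/

section LLN

/-- Kronecker's lemma: by Abel summation the average is the difference between `s n` and the Cesàro
mean of `s`, and both converge to `a`. -/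
lemma tendsto_avg_of_tendsto_sum_div {x : ℕ → ℝ} {a : ℝ}
    (h : Tendsto (fun n => ∑ i ∈ Finset.range n, x i / (i + 1)) atTop (𝓝 a)) :
    Tendsto (fun n : ℕ => (∑ i ∈ Finset.range n, x i) / n) atTop (𝓝 0) := by
  set s : ℕ → ℝ := fun n => ∑ i ∈ Finset.range n, x i / (i + 1) with hs
  have key : ∀ n : ℕ, ∑ i ∈ Finset.range n, x i = n * s n - ∑ i ∈ Finset.range n, s i := by
    intro n
    induction n with
    | zero => simp
    | succ n ih =>
      have h1 : s (n + 1) = s n + x n / (n + 1) := Finset.sum_range_succ _ _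
      rw [Finset.sum_range_succ, Finset.sum_range_succ, ih, h1]
      push_cast
      field_simp
      ring
  have h2 := h.sub h.cesaro
  rw [sub_self] at h2
  refine h2.congr' ?_
  filter_upwards [eventually_gt_atTop 0] with n hn
  have : (0 : ℝ) < n := by exact_mod_cast hn
  rw [key n]
  field_simp

variable {Ω : Type*} {m0 : MeasurableSpace Ω} {μ : Measure Ω} [IsFiniteMeasure μ]

lemma integral_sq_sub_condExp_le {m : MeasurableSpace Ω} (hm : m ≤ m0) {U : Ω → ℝ}
    (hU : MemLp U 2 μ) : ∫ ω, (U ω - μ[U | m] ω) ^ 2 ∂μ ≤ ∫ ω, U ω ^ 2 ∂μ := by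
  have h1 := integral_mono_ae integrable_condVar integrable_condExp (condVar_ae_le_condExp_sq hm hU)
  rw [integral_condExp hm] at h1
  rw [condVar, integral_condExp hm] at h1
  exact h1

/-- Strong law of large numbers for the martingale differences `U i - E[U i | ℱ i]`, when the
second moments of the `U i` are bounded. -/
theorem tendsto_avg_sub_condExp {ℱ : Filtration ℕ m0} {U : ℕ → Ω → ℝ}
    (hUm : ∀ i, StronglyMeasurable[ℱ (i + 1)] (U i)) (hU2 : ∀ i, MemLp (U i) 2 μ) {C : ℝ}
    (hC : ∀ i, ∫ ω, U i ω ^ 2 ∂μ ≤ C) :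
    ∀ᵐ ω ∂μ, Tendsto (fun n : ℕ => (∑ i ∈ Finset.range n, (U i ω - μ[U i | ℱ i] ω)) / n)
      atTop (𝓝 0) := by
  set X : ℕ → Ω → ℝ := fun i ω => U i ω - μ[U i | ℱ i] ω with hX
  have hX2 : ∀ i, MemLp (X i) 2 μ := fun i => (hU2 i).sub ((hU2 i).condExp one_le_two)
  have hXm : ∀ i, StronglyMeasurable[ℱ (i + 1)] (X i) := fun i =>
    (hUm i).sub (stronglyMeasurable_condExp.mono (ℱ.mono i.le_succ))
  have hXC : ∀ i, ∫ ω, X i ω ^ 2 ∂μ ≤ C := fun i =>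
    (integral_sq_sub_condExp_le (ℱ.le i) (hU2 i)).trans (hC i)
  have hX0 : ∀ i, μ[X i | ℱ i] =ᵐ[μ] 0 := by
    intro i
    have h1 := condExp_sub ((hU2 i).integrable one_le_two)
      (integrable_condExp (μ := μ) (m := ℱ i) (f := U i)) (ℱ i)
    refine h1.trans ?_
    rw [condExp_of_stronglyMeasurable (ℱ.le i) stronglyMeasurable_condExp integrable_condExp,
      sub_self]
  -- The weights `1/(i + 1)` are square-summable, so this martingale is bounded in `L²` and
  -- converges almost surely.
  set S : ℕ → Ω → ℝ := fun n ω => ∑ i ∈ Finset.range n, X i ω / (i + 1) with hS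
  have hSm : ∀ n, StronglyMeasurable[ℱ n] (S n) := by
    intro n
    refine Finset.stronglyMeasurable_fun_sum _ fun i hi => ?_
    simp only [div_eq_mul_inv]
    exact ((hXm i).mono (ℱ.mono (Finset.mem_range.1 hi))).mul_const _
  have hS2 : ∀ n, MemLp (S n) 2 μ := by
    intro n
    refine memLp_finsetSum _ fun i _ => ?_
    simp only [div_eq_inv_mul]
    exact (hX2 i).const_mul _
  have hSsucc : ∀ n, S (n + 1) = S n + fun ω => X n ω / (n + 1) := by
    intro n
    ext ω
    exact Finset.sum_range_succ _ _
  have hXd : ∀ n : ℕ, (fun ω => X n ω / (n + 1)) = ((n : ℝ) + 1)⁻¹ • X n := by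
    intro n
    ext ω
    simp [div_eq_inv_mul]
  have hmart : Martingale S ℱ μ := by
    refine martingale_nat hSm (fun n => (hS2 n).integrable one_le_two) fun n => ?_
    rw [hSsucc, hXd]
    have h1 := condExp_add ((hS2 n).integrable one_le_two)
      (((hX2 n).integrable one_le_two).smul ((n : ℝ) + 1)⁻¹) (ℱ n)
    have h2 := condExp_smul (μ := μ) ((n : ℝ) + 1)⁻¹ (X n) (ℱ n)
    rw [condExp_of_stronglyMeasurable (ℱ.le n) (hSm n) ((hS2 n).integrable one_le_two)] at h1
    filter_upwards [h1, h2, hX0 n] with ω e1 e2 e3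
    rw [e1, Pi.add_apply, e2, Pi.smul_apply, e3]
    simp
  have horth : ∀ n, ∫ ω, S n ω * X n ω ∂μ = 0 := by
    intro n
    have h1 := condExp_mul_of_stronglyMeasurable_left (hSm n)
      ((hS2 n).integrable_mul (hX2 n)) ((hX2 n).integrable one_le_two)
    rw [← integral_condExp (ℱ.le n)]
    refine integral_eq_zero_of_ae ?_
    filter_upwards [h1, hX0 n] with ω e1 e2
    refine e1.trans ?_
    simp [e2]
  have hSsq : ∀ n, ∫ ω, S n ω ^ 2 ∂μ ≤ ∑ i ∈ Finset.range n, C * (1 / ((i : ℝ) + 1) ^ 2) := by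
    intro n
    induction n with
    | zero => simp [hS]
    | succ n ih =>
      rw [Finset.sum_range_succ]
      have h1 : ∀ ω, S (n + 1) ω ^ 2
          = S n ω ^ 2 + 2 / ((n : ℝ) + 1) * (S n ω * X n ω)
            + 1 / ((n : ℝ) + 1) ^ 2 * X n ω ^ 2 := by
        intro ω
        rw [hSsucc, Pi.add_apply]
        field_simp
        ring
      have i1 := (hS2 n).integrable_sq
      have i2 : Integrable (fun ω => S n ω * X n ω) μ := (hS2 n).integrable_mul (hX2 n)
      have i3 := (hX2 n).integrable_sq
      have i12 : Integrable (fun ω => S n ω ^ 2 + 2 / ((n : ℝ) + 1) * (S n ω * X n ω)) μ :=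
        i1.add (i2.const_mul _)
      simp only [h1]
      rw [integral_add i12 (i3.const_mul _),
        integral_add i1 (i2.const_mul _), integral_const_mul, integral_const_mul, horth n]
      have := mul_le_mul_of_nonneg_left (hXC n) (by positivity : 0 ≤ 1 / ((n : ℝ) + 1) ^ 2)
      linarith
  have hC0 : 0 ≤ C := (integral_nonneg fun ω => sq_nonneg (U 0 ω)).trans (hC 0)
  have hsummable : Summable fun i : ℕ => 1 / ((i : ℝ) + 1) ^ 2 := by
    have := (summable_nat_add_iff 1).2 (Real.summable_one_div_nat_pow.2 one_lt_two)
    simpa using this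
  set T := ∑' i : ℕ, 1 / ((i : ℝ) + 1) ^ 2 with hT
  have hST : ∀ n, ∫ ω, S n ω ^ 2 ∂μ ≤ C * T := by
    intro n
    refine (hSsq n).trans ?_
    rw [← Finset.mul_sum]
    exact mul_le_mul_of_nonneg_left (hsummable.sum_le_tsum _ fun i _ => by positivity) hC0
  -- The convergence theorem asks for an `L¹` bound, obtained from `|S| ≤ 1 + S²`.
  have hbdd : ∀ n, eLpNorm (S n) 1 μ ≤ (Real.toNNReal (μ.real Set.univ + C * T) : ENNReal) := by
    intro n
    rw [eLpNorm_one_eq_lintegral_enorm,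
      ← ofReal_integral_norm_eq_lintegral_enorm ((hS2 n).integrable one_le_two)]
    refine ENNReal.ofReal_le_ofReal ?_
    calc ∫ ω, ‖S n ω‖ ∂μ ≤ ∫ ω, (1 + S n ω ^ 2) ∂μ := by
          refine integral_mono ((hS2 n).integrable one_le_two).norm
            ((integrable_const _).add (hS2 n).integrable_sq) fun ω => ?_
          rw [Real.norm_eq_abs]
          have := sq_abs (S n ω)
          nlinarith [sq_nonneg (|S n ω| - 1)]
      _ = μ.real Set.univ + ∫ ω, S n ω ^ 2 ∂μ := by
          rw [integral_add (integrable_const _) (hS2 n).integrable_sq]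
          simp
      _ ≤ _ := by linarith [hST n]
  filter_upwards [hmart.submartingale.ae_tendsto_limitProcess hbdd] with ω hω
  exact tendsto_avg_of_tendsto_sum_div hω

end LLN

/-! ### Poisson weights and their moments -/

section PoissonWeights

/-- The Poisson weights `exp (-l) * l ^ k / k!`. -/
def poissonWeight (l : ℝ) (k : ℕ) : ℝ := Real.exp (-l) * l ^ k / k.factorial

lemma poissonWeight_nonneg {l : ℝ} (hl : 0 ≤ l) (k : ℕ) : 0 ≤ poissonWeight l k := by
  unfold poissonWeight; positivity

lemma measurable_poissonWeight (k : ℕ) : Measurable fun l => poissonWeight l k := by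
  unfold poissonWeight; fun_prop

lemma le_poissonWeight {m K l : ℝ} (hm : 0 ≤ m) (hml : m ≤ l) (hlK : l ≤ K) (k : ℕ) :
    Real.exp (-K) * m ^ k / k.factorial ≤ poissonWeight l k := by
  unfold poissonWeight
  gcongr

/-- The Poisson moment generating function; the identity holds for every real `l`, so no sign
condition has to be carried along. -/
lemma hasSum_exp_mul_poissonWeight (s l : ℝ) :
    HasSum (fun k : ℕ => Real.exp (s * k) * poissonWeight l k)
      (Real.exp (l * (Real.exp s - 1))) := by
  have h := (NormedSpace.expSeries_div_hasSum_exp (l * Real.exp s)).mul_left (Real.exp (-l))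
  rw [← Real.exp_eq_exp_ℝ, ← Real.exp_add] at h
  have e1 : -l + l * Real.exp s = l * (Real.exp s - 1) := by ring
  rw [e1] at h
  refine h.congr_fun fun k => ?_
  unfold poissonWeight
  rw [mul_pow, ← Real.exp_nat_mul, mul_comm s]
  ring

lemma hasSum_poissonWeight (l : ℝ) : HasSum (fun k : ℕ => poissonWeight l k) 1 := by
  simpa using hasSum_exp_mul_poissonWeight 0 l

lemma hasSum_mul_poissonWeight (l : ℝ) : HasSum (fun k : ℕ => (k : ℝ) * poissonWeight l k) l := by
  have h := (hasSum_poissonWeight l).mul_left l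
  rw [mul_one] at h
  rw [← hasSum_nat_add_iff' 1]
  simp only [Finset.range_one, Finset.sum_singleton, Nat.cast_zero, zero_mul, sub_zero]
  refine h.congr_fun fun k => ?_
  unfold poissonWeight
  rw [Nat.factorial_succ, pow_succ]
  push_cast
  have : (k.factorial : ℝ) ≠ 0 := by exact_mod_cast k.factorial_ne_zero
  field_simp

lemma hasSum_indicator_poissonWeight (l : ℝ) (y : ℕ) :
    HasSum (fun k : ℕ => (if k = y then (1 : ℝ) else 0) * poissonWeight l k)
      (poissonWeight l y) := by
  have h := hasSum_ite_eq y (poissonWeight l y)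
  refine h.congr_fun fun k => ?_
  split_ifs with hk
  · rw [hk, one_mul]
  · rw [zero_mul]

end PoissonWeights

/-! ### Conditional expectations in the Poisson model -/

variable {Ω : Type*} {m0 : MeasurableSpace Ω}

/-- Counts `N 0, N 1, …` adapted to the filtration `ℱ` (shifted by one) such that the conditional
law of `N i` given `ℱ i` is Poisson with mean given by the recursion with parameter `θ₀` from the
initial value `L`. -/
structure PoissonModel (μ : Measure Ω) (ℱ : Filtration ℕ m0) (θ₀ : Param) (L : Ω → ℝ)
    (N : Ω → ℕ → ℕ) : Prop where
  count_meas : ∀ i, Measurable[ℱ (i + 1)] fun ω => N ω i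
  init_meas : Measurable[ℱ 0] L
  init_pos : ∀ ω, 0 < L ω
  law : ∀ (i k : ℕ) (S : Set Ω), MeasurableSet[ℱ i] S →
    μ (S ∩ {ω | N ω i = k})
      = ∫⁻ ω in S, ENNReal.ofReal (poissonWeight (traj θ₀ (L ω) (N ω) i) k) ∂μ

namespace PoissonModel

variable {μ : Measure Ω} {ℱ : Filtration ℕ m0} {θ₀ : Param} {L : Ω → ℝ} {N : Ω → ℕ → ℕ}

lemma measurable_intensity (θ : Param) : Measurable fun p : ℕ × ℝ => intensity θ p.1 p.2 := by
  refine measurable_from_prod_countable_right fun y => ?_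
  obtain ⟨A, M, hAM⟩ := exists_intensity_eq_affine θ y
  simp only [hAM]
  fun_prop

lemma measurable_traj (h : PoissonModel μ ℱ θ₀ L N) (θ : Param) {l : Ω → ℝ}
    (hl : Measurable[ℱ 0] l) (i : ℕ) : Measurable[ℱ i] fun ω => traj θ (l ω) (N ω) i := by
  induction i with
  | zero => exact hl
  | succ i ih =>
    exact (measurable_intensity θ).comp ((h.count_meas i).prodMk (ih.mono (ℱ.mono i.le_succ) le_rfl))

lemma measurableSet_count (h : PoissonModel μ ℱ θ₀ L N) (i k : ℕ) :
    MeasurableSet[ℱ (i + 1)] {ω | N ω i = k} :=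
  h.count_meas i (measurableSet_singleton k)

lemma measurable_intensity_process (h : PoissonModel μ ℱ θ₀ L N) (i : ℕ) :
    Measurable fun ω => traj θ₀ (L ω) (N ω) i :=
  (h.measurable_traj θ₀ h.init_meas i).mono (ℱ.le i) le_rfl

lemma measurable_count (h : PoissonModel μ ℱ θ₀ L N) (i : ℕ) :
    Measurable fun ω => (N ω i : ℝ) :=
  (measurable_from_top (f := fun k : ℕ => (k : ℝ))).comp
    ((h.count_meas i).mono (ℱ.le (i + 1)) le_rfl)

/-- The conditional law says that two measures coincide on `ℱ i`; hence they integrate `ℱ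
i`-measurable functions alike. -/
lemma setLIntegral_count (h : PoissonModel μ ℱ θ₀ L N) [IsFiniteMeasure μ] {i : ℕ}
    {Z : Ω → ENNReal} (hZ : Measurable[ℱ i] Z) (k : ℕ) :
    ∫⁻ ω in {ω | N ω i = k}, Z ω ∂μ
      = ∫⁻ ω, Z ω * ENNReal.ofReal (poissonWeight (traj θ₀ (L ω) (N ω) i) k) ∂μ := by
  have hw : Measurable[ℱ i] fun ω =>
      ENNReal.ofReal (poissonWeight (traj θ₀ (L ω) (N ω) i) k) :=
    ENNReal.measurable_ofReal.comp
      ((measurable_poissonWeight k).comp (h.measurable_traj θ₀ h.init_meas i))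
  have hw0 := hw.mono (ℱ.le i) le_rfl
  have hms : MeasurableSet {ω | N ω i = k} := ℱ.le _ _ (h.measurableSet_count i k)
  have hext : (μ.restrict {ω | N ω i = k}).trim (ℱ.le i)
      = (μ.withDensity fun ω =>
          ENNReal.ofReal (poissonWeight (traj θ₀ (L ω) (N ω) i) k)).trim (ℱ.le i) := by
    refine @Measure.ext _ (ℱ i) _ _ fun S hS => ?_
    rw [trim_measurableSet_eq _ hS, trim_measurableSet_eq _ hS,
      Measure.restrict_apply (ℱ.le i _ hS), withDensity_apply _ (ℱ.le i _ hS), h.law i k S hS]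
  rw [← lintegral_trim (ℱ.le i) hZ, hext, lintegral_trim (ℱ.le i) hZ,
    lintegral_withDensity_eq_lintegral_mul _ hw0 (hZ.mono (ℱ.le i) le_rfl)]
  simp only [Pi.mul_apply, mul_comm]

variable {δ ρ B : ℝ} {f : ℕ → ℝ} {v : ℝ → ℝ}

/-- Summation over the values of the count. Working in `ENNReal` requires no integrability, so the
identity can be used to establish it. -/
lemma lintegral_mul_count (h : PoissonModel μ ℱ θ₀ L N) [IsFiniteMeasure μ]
    (hb : CoefBound δ ρ B θ₀) (hδ : 0 < δ) {i : ℕ} {Z : Ω → ENNReal} (hZ : Measurable[ℱ i] Z)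
    (hf : ∀ k, 0 ≤ f k) (hv : ∀ l, HasSum (fun k => f k * poissonWeight l k) (v l)) :
    ∫⁻ ω, Z ω * ENNReal.ofReal (f (N ω i)) ∂μ
      = ∫⁻ ω, Z ω * ENNReal.ofReal (v (traj θ₀ (L ω) (N ω) i)) ∂μ := by
  have hZ0 := hZ.mono (ℱ.le i) le_rfl
  have hms : ∀ k, MeasurableSet {ω | N ω i = k} := fun k => ℱ.le _ _ (h.measurableSet_count i k)
  have hw : ∀ k, Measurable fun ω =>
      ENNReal.ofReal (poissonWeight (traj θ₀ (L ω) (N ω) i) k) := fun k =>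
    ENNReal.measurable_ofReal.comp ((measurable_poissonWeight k).comp
      ((h.measurable_traj θ₀ h.init_meas i).mono (ℱ.le i) le_rfl))
  have hZw : ∀ k, Measurable fun ω =>
      Z ω * ENNReal.ofReal (poissonWeight (traj θ₀ (L ω) (N ω) i) k) := fun k => hZ0.mul (hw k)
  have h1 : ∀ ω, Z ω * ENNReal.ofReal (f (N ω i))
      = ∑' k, {ω | N ω i = k}.indicator (fun ω => Z ω * ENNReal.ofReal (f k)) ω := by
    intro ω
    rw [tsum_eq_single (N ω i) fun k hk => Set.indicator_of_notMem (fun h' => hk h'.symm) _]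
    rw [Set.indicator_of_mem (by rfl)]
  have h2 : ∀ ω, Z ω * ENNReal.ofReal (v (traj θ₀ (L ω) (N ω) i))
      = ∑' k, Z ω * ENNReal.ofReal (poissonWeight (traj θ₀ (L ω) (N ω) i) k)
          * ENNReal.ofReal (f k) := by
    intro ω
    have hT := (traj_pos hb hδ (h.init_pos ω) (N ω) i).le
    rw [← (hv _).tsum_eq, ENNReal.ofReal_tsum_of_nonneg
      (fun k => mul_nonneg (hf k) (poissonWeight_nonneg hT k)) (hv _).summable,
      ← ENNReal.tsum_mul_left]
    refine tsum_congr fun k => ?_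
    rw [ENNReal.ofReal_mul (hf k)]
    ring
  simp only [h1, h2]
  rw [lintegral_tsum fun k => ((hZ0.mul_const _).indicator (hms k)).aemeasurable,
    lintegral_tsum fun k => ((hZw k).mul_const _).aemeasurable]
  refine tsum_congr fun k => ?_
  rw [lintegral_indicator (hms k), lintegral_mul_const _ hZ0,
    lintegral_mul_const _ (hZw k), h.setLIntegral_count hZ k]

lemma condExp_count (h : PoissonModel μ ℱ θ₀ L N) [IsFiniteMeasure μ]
    (hb : CoefBound δ ρ B θ₀) (hδ : 0 < δ) {i : ℕ}
    (hf : ∀ k, 0 ≤ f k) (hv : ∀ l, HasSum (fun k => f k * poissonWeight l k) (v l))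
    (hvm : Measurable v) (hint : Integrable (fun ω => f (N ω i)) μ) :
    μ[fun ω => f (N ω i) | ℱ i] =ᵐ[μ] fun ω => v (traj θ₀ (L ω) (N ω) i) := by
  have hvm' : Measurable[ℱ i] fun ω => v (traj θ₀ (L ω) (N ω) i) :=
    hvm.comp (h.measurable_traj θ₀ h.init_meas i)
  have hv0 : ∀ ω, 0 ≤ v (traj θ₀ (L ω) (N ω) i) := fun ω => (hv _).nonneg fun k =>
    mul_nonneg (hf k) (poissonWeight_nonneg (traj_pos hb hδ (h.init_pos ω) (N ω) i).le k)
  have key : ∀ S, MeasurableSet[ℱ i] S → ∫⁻ ω in S, ENNReal.ofReal (f (N ω i)) ∂μ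
      = ∫⁻ ω in S, ENNReal.ofReal (v (traj θ₀ (L ω) (N ω) i)) ∂μ := by
    intro S hS
    have hS1 : Measurable[ℱ i] (S.indicator fun _ => (1 : ENNReal)) :=
      Measurable.indicator (m := ℱ i) (@measurable_const _ _ _ (ℱ i) 1) hS
    have h1 := h.lintegral_mul_count hb hδ hS1 hf hv
    rw [← lintegral_indicator (ℱ.le i S hS), ← lintegral_indicator (ℱ.le i S hS)]
    convert h1 using 2 <;>
    · ext ω
      by_cases hω : ω ∈ S <;> simp [hω]
  have hvint : Integrable (fun ω => v (traj θ₀ (L ω) (N ω) i)) μ := by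
    rw [← lintegral_ofReal_ne_top_iff_integrable (hvm'.mono (ℱ.le i) le_rfl).aestronglyMeasurable
      (ae_of_all _ hv0)]
    have h1 := key Set.univ MeasurableSet.univ
    rw [Measure.restrict_univ] at h1
    rw [← h1]
    exact (lintegral_ofReal_ne_top_iff_integrable hint.1 (ae_of_all _ fun ω => hf _)).2 hint
  symm
  refine ae_eq_condExp_of_forall_setIntegral_eq (ℱ.le i) hint (fun S _ _ => hvint.integrableOn)
    (fun S hS _ => ?_) hvm'.stronglyMeasurable.aestronglyMeasurable
  rw [integral_eq_lintegral_of_nonneg_ae (ae_of_all _ hv0) hvint.1.restrict,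
    integral_eq_lintegral_of_nonneg_ae (ae_of_all _ fun ω => hf _) hint.1.restrict, key S hS]

lemma condExp_mul_count (h : PoissonModel μ ℱ θ₀ L N) [IsFiniteMeasure μ]
    (hb : CoefBound δ ρ B θ₀) (hδ : 0 < δ) {i : ℕ}
    (hf : ∀ k, 0 ≤ f k) (hv : ∀ l, HasSum (fun k => f k * poissonWeight l k) (v l))
    (hvm : Measurable v) (hint : Integrable (fun ω => f (N ω i)) μ) {Z : Ω → ℝ}
    (hZ : Measurable[ℱ i] Z) (hZint : Integrable (fun ω => Z ω * f (N ω i)) μ) :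
    μ[fun ω => Z ω * f (N ω i) | ℱ i]
      =ᵐ[μ] fun ω => Z ω * v (traj θ₀ (L ω) (N ω) i) := by
  refine (condExp_mul_of_stronglyMeasurable_left hZ.stronglyMeasurable hZint hint).trans ?_
  filter_upwards [h.condExp_count hb hδ hf hv hvm hint] with ω hω
  rw [Pi.mul_apply, hω]

end PoissonModel

/-! ### Exponential drift and moments -/

/-- Exponential drift towards bounded intensities. -/
lemma exists_exp_drift {θ₀ : Param} (hθ : θ₀.2 ∈ bigTheta) :
    ∃ u₀ > 0, ∀ u, 0 < u → u ≤ u₀ → ∃ c C', 0 < c ∧ 0 ≤ C' ∧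
      (∀ (y : ℕ) (l : ℝ), 0 ≤ l → Real.exp (u * intensity θ₀ y l)
        ≤ c * Real.exp (u * θ₀.2 1 * l)
          + c * Real.exp (u * θ₀.2 4 * l) * Real.exp (u * θ₀.2 5 * y)) ∧
      ∀ l : ℝ, 0 ≤ l → c * Real.exp (u * θ₀.2 1 * l)
        + c * Real.exp (u * θ₀.2 4 * l) * Real.exp (l * (Real.exp (u * θ₀.2 5) - 1))
          ≤ 1 / 2 * Real.exp (u * l) + C' := by
  obtain ⟨hpos, ha₁, -, hab⟩ := hθ
  have hb1 : θ₀.2 5 < 1 := by linarith [hpos 4]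
  -- `u ≤ 1` permits `exp (u b₂) - 1 ≤ u (b₂ + u)`; the other bound keeps `a₂ + b₂ + u < 1`, which
  -- leaves room for a rate `κ < 1` common to both regimes.
  refine ⟨min 1 ((1 - θ₀.2 4 - θ₀.2 5) / 2), lt_min one_pos (by linarith), fun u hu huu => ?_⟩
  have hu1 : u ≤ 1 := huu.trans (min_le_left _ _)
  have hu2 : u ≤ (1 - θ₀.2 4 - θ₀.2 5) / 2 := huu.trans (min_le_right _ _)
  obtain ⟨κ, hκ1, hκa, hκb⟩ : ∃ κ, κ < 1 ∧ θ₀.2 1 ≤ κ ∧ θ₀.2 4 + θ₀.2 5 + u ≤ κ :=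
    ⟨max (θ₀.2 1) (θ₀.2 4 + θ₀.2 5 + u), max_lt ha₁ (by linarith), le_max_left _ _,
      le_max_right _ _⟩
  have hκ0 : 0 < κ := (hpos 1).trans_le hκa
  -- `c` absorbs both intercepts and the largest lower-regime count contribution `b₁ r`. Beyond `x₀`
  -- the term `2c exp (uκl)` is at most half of `exp (ul)`; below `x₀` it is bounded by the
  -- constant.
  set c := Real.exp (u * (θ₀.2 0 + θ₀.2 2 * θ₀.1 + θ₀.2 3)) with hc
  set x₀ := Real.log (4 * c) / (u * (1 - κ)) with hx₀
  have huκ : 0 < u * (1 - κ) := mul_pos hu (by linarith)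
  have hr : (0 : ℝ) ≤ θ₀.1 := Nat.cast_nonneg _
  have hc0 : 0 < c := Real.exp_pos _
  refine ⟨c, 2 * c * Real.exp (u * κ * x₀), hc0, by positivity, fun y l hl => ?_, fun l hl => ?_⟩
  · unfold intensity Param.d₁ Param.a₁ Param.b₁ Param.d₂ Param.a₂ Param.b₂
    split_ifs with hy
    · have hy' : (y : ℝ) ≤ θ₀.1 := by exact_mod_cast hy
      refine le_add_of_le_of_nonneg ?_ (by positivity)
      rw [hc, ← Real.exp_add, Real.exp_le_exp]
      have := mul_le_mul_of_nonneg_left hy' (hpos 2).le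
      nlinarith [mul_le_mul_of_nonneg_left this hu.le, mul_pos hu (hpos 3)]
    · refine le_add_of_nonneg_of_le (by positivity) ?_
      rw [hc, ← Real.exp_add, ← Real.exp_add, Real.exp_le_exp]
      have := mul_nonneg (hpos 2).le hr
      nlinarith [mul_nonneg hu.le this, mul_pos hu (hpos 0)]
  · have hexp : Real.exp (u * θ₀.2 5) - 1 ≤ u * (θ₀.2 5 + u) := by
      have h0 : 0 < u * θ₀.2 5 := mul_pos hu (hpos 5)
      have h1 : u * θ₀.2 5 ≤ u := by nlinarith
      have h2 := le_of_abs_le (Real.abs_exp_sub_one_sub_id_le (x := u * θ₀.2 5)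
        (by rw [abs_of_pos h0]; linarith))
      have h3 : (u * θ₀.2 5) ^ 2 ≤ u ^ 2 := pow_le_pow_left₀ h0.le h1 2
      nlinarith
    have e1 : Real.exp (u * θ₀.2 1 * l) ≤ Real.exp (u * κ * l) := by
      gcongr
    have e2 : Real.exp (u * θ₀.2 4 * l) * Real.exp (l * (Real.exp (u * θ₀.2 5) - 1))
        ≤ Real.exp (u * κ * l) := by
      rw [← Real.exp_add, Real.exp_le_exp]
      have := mul_le_mul_of_nonneg_left hexp hl
      have := mul_le_mul_of_nonneg_left hκb (mul_nonneg hu.le hl)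
      nlinarith
    have e3 : 2 * c * Real.exp (u * κ * l)
        ≤ 1 / 2 * Real.exp (u * l) + 2 * c * Real.exp (u * κ * x₀) := by
      rcases le_total x₀ l with h | h
      · have h1 : 4 * c ≤ Real.exp (u * (1 - κ) * l) := by
          rw [← Real.log_le_iff_le_exp (by positivity)]
          rw [hx₀, div_le_iff₀ huκ] at h
          linarith
        have h2 : Real.exp (u * l) = Real.exp (u * κ * l) * Real.exp (u * (1 - κ) * l) := by
          rw [← Real.exp_add]; ring_nf
        have h3 := mul_le_mul_of_nonneg_left h1 (Real.exp_pos (u * κ * l)).le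
        have h4 : 0 ≤ 2 * c * Real.exp (u * κ * x₀) := by positivity
        rw [h2]
        linarith
      · have h1 : Real.exp (u * κ * l) ≤ Real.exp (u * κ * x₀) := by gcongr
        have h2 := mul_le_mul_of_nonneg_left h1 (by positivity : 0 ≤ 2 * c)
        have h3 := Real.exp_pos (u * l)
        linarith
    have := mul_le_mul_of_nonneg_left e1 hc0.le
    have := mul_le_mul_of_nonneg_left e2 hc0.le
    nlinarith

namespace PoissonModel

variable {Ω : Type*} {m0 : MeasurableSpace Ω} {μ : Measure Ω} [IsFiniteMeasure μ]
  {ℱ : Filtration ℕ m0} {θ₀ : Param} {L : Ω → ℝ} {N : Ω → ℕ → ℕ} {δ ρ B : ℝ}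

/-- The drift in integrated form, in `ENNReal`, so that integrability passes from one time to the
next by induction. -/
lemma lintegral_exp_succ_le (h : PoissonModel μ ℱ θ₀ L N) (hb : CoefBound δ ρ B θ₀) (hδ : 0 < δ)
    {u c C' : ℝ} (hc : 0 < c)
    (h1 : ∀ (y : ℕ) (l : ℝ), 0 ≤ l → Real.exp (u * intensity θ₀ y l)
        ≤ c * Real.exp (u * θ₀.2 1 * l)
          + c * Real.exp (u * θ₀.2 4 * l) * Real.exp (u * θ₀.2 5 * y))
    (h2 : ∀ l : ℝ, 0 ≤ l → c * Real.exp (u * θ₀.2 1 * l)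
        + c * Real.exp (u * θ₀.2 4 * l) * Real.exp (l * (Real.exp (u * θ₀.2 5) - 1))
          ≤ 1 / 2 * Real.exp (u * l) + C') (i : ℕ) :
    ∫⁻ ω, ENNReal.ofReal (Real.exp (u * traj θ₀ (L ω) (N ω) (i + 1))) ∂μ
      ≤ ∫⁻ ω, ENNReal.ofReal (1 / 2 * Real.exp (u * traj θ₀ (L ω) (N ω) i) + C') ∂μ := by
  have hΛ : ∀ ω, 0 ≤ traj θ₀ (L ω) (N ω) i := fun ω => (traj_pos hb hδ (h.init_pos ω) (N ω) i).le
  have hΛm := h.measurable_traj θ₀ h.init_meas i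
  have hZ1 : Measurable fun ω => ENNReal.ofReal (c * Real.exp (u * θ₀.2 1 *
      traj θ₀ (L ω) (N ω) i)) := by
    have := h.measurable_intensity_process i
    fun_prop
  have hZ2 : Measurable[ℱ i] fun ω => ENNReal.ofReal (c * Real.exp (u * θ₀.2 4 *
      traj θ₀ (L ω) (N ω) i)) :=
    (by fun_prop : Measurable fun x : ℝ => ENNReal.ofReal (c * Real.exp (u * θ₀.2 4 * x))).comp hΛm
  calc ∫⁻ ω, ENNReal.ofReal (Real.exp (u * traj θ₀ (L ω) (N ω) (i + 1))) ∂μ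
      ≤ ∫⁻ ω, (ENNReal.ofReal (c * Real.exp (u * θ₀.2 1 * traj θ₀ (L ω) (N ω) i))
        + ENNReal.ofReal (c * Real.exp (u * θ₀.2 4 * traj θ₀ (L ω) (N ω) i))
          * ENNReal.ofReal (Real.exp (u * θ₀.2 5 * N ω i))) ∂μ := by
        refine lintegral_mono fun ω => ?_
        rw [← ENNReal.ofReal_mul (by positivity), ← ENNReal.ofReal_add (by positivity)
          (by positivity)]
        exact ENNReal.ofReal_le_ofReal (h1 _ _ (hΛ ω))
    _ = ∫⁻ ω, (ENNReal.ofReal (c * Real.exp (u * θ₀.2 1 * traj θ₀ (L ω) (N ω) i))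
        + ENNReal.ofReal (c * Real.exp (u * θ₀.2 4 * traj θ₀ (L ω) (N ω) i))
          * ENNReal.ofReal (Real.exp (traj θ₀ (L ω) (N ω) i
            * (Real.exp (u * θ₀.2 5) - 1)))) ∂μ := by
        rw [lintegral_add_left hZ1, lintegral_add_left hZ1]
        congr 1
        exact h.lintegral_mul_count hb hδ hZ2 (f := fun k => Real.exp (u * θ₀.2 5 * k))
          (fun k => (Real.exp_pos _).le) (fun l => hasSum_exp_mul_poissonWeight _ l)
    _ ≤ _ := by
        refine lintegral_mono fun ω => ?_
        rw [← ENNReal.ofReal_mul (by positivity), ← ENNReal.ofReal_add (by positivity)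
          (by positivity)]
        exact ENNReal.ofReal_le_ofReal (h2 _ (hΛ ω))

/-- Uniform exponential moments of the intensities, for bounded initial intensity. -/
lemma exists_exp_moment (h : PoissonModel μ ℱ θ₀ L N) (hb : CoefBound δ ρ B θ₀) (hδ : 0 < δ)
    {K : ℝ} (hK : ∀ᵐ ω ∂μ, L ω ≤ K) {u c C' : ℝ} (hu : 0 < u) (hc : 0 < c) (hC' : 0 ≤ C')
    (h1 : ∀ (y : ℕ) (l : ℝ), 0 ≤ l → Real.exp (u * intensity θ₀ y l)
        ≤ c * Real.exp (u * θ₀.2 1 * l)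
          + c * Real.exp (u * θ₀.2 4 * l) * Real.exp (u * θ₀.2 5 * y))
    (h2 : ∀ l : ℝ, 0 ≤ l → c * Real.exp (u * θ₀.2 1 * l)
        + c * Real.exp (u * θ₀.2 4 * l) * Real.exp (l * (Real.exp (u * θ₀.2 5) - 1))
          ≤ 1 / 2 * Real.exp (u * l) + C') :
    ∃ M, ∀ i, Integrable (fun ω => Real.exp (u * traj θ₀ (L ω) (N ω) i)) μ ∧
      ∫ ω, Real.exp (u * traj θ₀ (L ω) (N ω) i) ∂μ ≤ M := by
  have hm : ∀ i, AEStronglyMeasurable (fun ω => Real.exp (u * traj θ₀ (L ω) (N ω) i)) μ := by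
    intro i
    have := h.measurable_intensity_process i
    exact Measurable.aestronglyMeasurable (by fun_prop)
  -- Chosen to dominate the initial value and to be preserved by `M ↦ M/2 + C' μ(Ω)`.
  refine ⟨Real.exp (u * K) * μ.real Set.univ + 2 * (C' * μ.real Set.univ), fun i => ?_⟩
  induction i with
  | zero =>
    have hle : ∀ᵐ ω ∂μ, Real.exp (u * traj θ₀ (L ω) (N ω) 0) ≤ Real.exp (u * K) := by
      filter_upwards [hK] with ω hω
      have : traj θ₀ (L ω) (N ω) 0 ≤ K := hω
      gcongr
    have hint : Integrable (fun ω => Real.exp (u * traj θ₀ (L ω) (N ω) 0)) μ := by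
      refine Integrable.of_bound (hm 0) (Real.exp (u * K)) ?_
      filter_upwards [hle] with ω hω
      rwa [Real.norm_eq_abs, abs_of_pos (Real.exp_pos _)]
    refine ⟨hint, (integral_mono_ae hint (integrable_const _) hle).trans ?_⟩
    rw [integral_const, smul_eq_mul]
    have : 0 ≤ C' * μ.real Set.univ := by positivity
    linarith [mul_comm (Real.exp (u * K)) (μ.real Set.univ)]
  | succ i ih =>
    obtain ⟨hint, hle⟩ := ih
    have hint' : Integrable
        (fun ω => 1 / 2 * Real.exp (u * traj θ₀ (L ω) (N ω) i) + C') μ :=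
      (hint.const_mul _).add (integrable_const _)
    have hpos : ∀ ω, 0 ≤ 1 / 2 * Real.exp (u * traj θ₀ (L ω) (N ω) i) + C' := fun ω => by
      positivity
    have key := h.lintegral_exp_succ_le hb hδ hc h1 h2 i
    have hfin := (lintegral_ofReal_ne_top_iff_integrable hint'.1 (ae_of_all _ hpos)).2 hint'
    have hint1 : Integrable (fun ω => Real.exp (u * traj θ₀ (L ω) (N ω) (i + 1))) μ :=
      (lintegral_ofReal_ne_top_iff_integrable (hm _)
        (ae_of_all _ fun ω => (Real.exp_pos _).le)).1 (ne_top_of_le_ne_top hfin key)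
    refine ⟨hint1, ?_⟩
    have h3 : ∫ ω, Real.exp (u * traj θ₀ (L ω) (N ω) (i + 1)) ∂μ
        ≤ ∫ ω, (1 / 2 * Real.exp (u * traj θ₀ (L ω) (N ω) i) + C') ∂μ := by
      rw [integral_eq_lintegral_of_nonneg_ae (ae_of_all _ fun ω => (Real.exp_pos _).le) (hm _),
        integral_eq_lintegral_of_nonneg_ae (ae_of_all _ hpos) hint'.1]
      exact ENNReal.toReal_mono hfin key
    rw [integral_add (hint.const_mul _) (integrable_const _), integral_const_mul, integral_const,
      smul_eq_mul] at h3
    have : 0 ≤ Real.exp (u * K) * μ.real Set.univ := by positivity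
    linarith [mul_comm C' (μ.real Set.univ)]

lemma condExp_exp_succ_le (h : PoissonModel μ ℱ θ₀ L N) (hb : CoefBound δ ρ B θ₀) (hδ : 0 < δ)
    {u c C' : ℝ} (hu : 0 < u) (hc : 0 < c)
    (h1 : ∀ (y : ℕ) (l : ℝ), 0 ≤ l → Real.exp (u * intensity θ₀ y l)
        ≤ c * Real.exp (u * θ₀.2 1 * l)
          + c * Real.exp (u * θ₀.2 4 * l) * Real.exp (u * θ₀.2 5 * y))
    (h2 : ∀ l : ℝ, 0 ≤ l → c * Real.exp (u * θ₀.2 1 * l)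
        + c * Real.exp (u * θ₀.2 4 * l) * Real.exp (l * (Real.exp (u * θ₀.2 5) - 1))
          ≤ 1 / 2 * Real.exp (u * l) + C') {i : ℕ}
    (hint : Integrable (fun ω => Real.exp (u * traj θ₀ (L ω) (N ω) i)) μ)
    (hint1 : Integrable (fun ω => Real.exp (u * traj θ₀ (L ω) (N ω) (i + 1))) μ) :
    μ[fun ω => Real.exp (u * traj θ₀ (L ω) (N ω) (i + 1)) | ℱ i]
      ≤ᵐ[μ] fun ω => 1 / 2 * Real.exp (u * traj θ₀ (L ω) (N ω) i) + C' := by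
  have hΛ : ∀ ω, 0 ≤ traj θ₀ (L ω) (N ω) i := fun ω => (traj_pos hb hδ (h.init_pos ω) (N ω) i).le
  have hΛm := h.measurable_traj θ₀ h.init_meas i
  have hΛm0 := h.measurable_intensity_process i
  have hNm := h.measurable_count i
  have hint' : Integrable (fun ω => 1 / 2 * Real.exp (u * traj θ₀ (L ω) (N ω) i) + C') μ :=
    (hint.const_mul _).add (integrable_const _)
  set Z1 : Ω → ℝ := fun ω => c * Real.exp (u * θ₀.2 1 * traj θ₀ (L ω) (N ω) i) with hZ1
  set Z2 : Ω → ℝ := fun ω => c * Real.exp (u * θ₀.2 4 * traj θ₀ (L ω) (N ω) i) with hZ2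
  set f : ℕ → ℝ := fun k => Real.exp (u * θ₀.2 5 * k) with hf
  set v : ℝ → ℝ := fun l => Real.exp (l * (Real.exp (u * θ₀.2 5) - 1)) with hv
  have hf0 : ∀ k, 0 ≤ f k := fun k => (Real.exp_pos _).le
  have hsum : ∀ l, HasSum (fun k => f k * poissonWeight l k) (v l) := fun l =>
    hasSum_exp_mul_poissonWeight _ l
  have hvm : Measurable v := by fun_prop
  have hZ1m : Measurable[ℱ i] Z1 :=
    (by fun_prop : Measurable fun x : ℝ => c * Real.exp (u * θ₀.2 1 * x)).comp hΛm
  have hZ2m : Measurable[ℱ i] Z2 :=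
    (by fun_prop : Measurable fun x : ℝ => c * Real.exp (u * θ₀.2 4 * x)).comp hΛm
  have hfm : Measurable fun ω => f (N ω i) := by
    simp only [hf]; fun_prop
  have hZ1pos : ∀ ω, 0 < Z1 ω := fun ω => by simp only [hZ1]; positivity
  have hZ2pos : ∀ ω, 0 < Z2 ω := fun ω => by simp only [hZ2]; positivity
  have hdom : ∀ ω, Z1 ω + Z2 ω * v (traj θ₀ (L ω) (N ω) i)
      ≤ 1 / 2 * Real.exp (u * traj θ₀ (L ω) (N ω) i) + C' := fun ω => h2 _ (hΛ ω)
  have hZ2v : ∀ ω, 0 < Z2 ω * v (traj θ₀ (L ω) (N ω) i) := fun ω =>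
    mul_pos (hZ2pos ω) (Real.exp_pos _)
  have hZ1int : Integrable Z1 μ := by
    refine hint'.mono' (hZ1m.mono (ℱ.le i) le_rfl).aestronglyMeasurable (ae_of_all _ fun ω => ?_)
    rw [Real.norm_eq_abs, abs_of_pos (hZ1pos ω)]
    linarith [hdom ω, hZ2v ω]
  have hZ2vint : Integrable (fun ω => Z2 ω * v (traj θ₀ (L ω) (N ω) i)) μ := by
    refine hint'.mono' ((hZ2m.mono (ℱ.le i) le_rfl).mul (hvm.comp hΛm0)).aestronglyMeasurable
      (ae_of_all _ fun ω => ?_)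
    rw [Real.norm_eq_abs, abs_of_pos (hZ2v ω)]
    linarith [hdom ω, hZ1pos ω]
  have hZ2fint : Integrable (fun ω => Z2 ω * f (N ω i)) μ := by
    have hm : AEStronglyMeasurable (fun ω => Z2 ω * f (N ω i)) μ :=
      ((hZ2m.mono (ℱ.le i) le_rfl).mul hfm).aestronglyMeasurable
    rw [← lintegral_ofReal_ne_top_iff_integrable hm (ae_of_all _ fun ω => mul_nonneg (hZ2pos ω).le (hf0 _))]
    have e1 := (lintegral_ofReal_ne_top_iff_integrable hZ2vint.1
      (ae_of_all _ fun ω => (hZ2v ω).le)).2 hZ2vint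
    simp only [ENNReal.ofReal_mul (hZ2pos _).le] at e1 ⊢
    have e2 := h.lintegral_mul_count hb hδ (ENNReal.measurable_ofReal.comp hZ2m) hf0 hsum
    exact fun htop => e1 (e2.symm.trans htop)
  -- `Z2 ≥ c` because the intensity is nonnegative, so `f ≤ c⁻¹ Z2 f`.
  have hfint : Integrable (fun ω => f (N ω i)) μ := by
    refine (hZ2fint.const_mul c⁻¹).mono' hfm.aestronglyMeasurable (ae_of_all _ fun ω => ?_)
    rw [Real.norm_eq_abs, abs_of_nonneg (hf0 _), ← mul_assoc]
    refine le_mul_of_one_le_left (hf0 _) ?_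
    simp only [hZ2]
    rw [inv_mul_cancel_left₀ hc.ne']
    refine Real.one_le_exp ?_
    have : 0 < θ₀.2 4 := hδ.trans_le (hb.lower 4)
    have := hΛ ω
    positivity
  have hmono := condExp_mono (m := ℱ i) hint1 (hZ1int.add hZ2fint)
    (ae_of_all _ fun ω => h1 (N ω i) _ (hΛ ω))
  have hadd := condExp_add hZ1int hZ2fint (ℱ i)
  rw [condExp_of_stronglyMeasurable (ℱ.le i) hZ1m.stronglyMeasurable hZ1int] at hadd
  filter_upwards [hmono, hadd, h.condExp_mul_count hb hδ hf0 hsum hvm hfint hZ2m hZ2fint]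
    with ω e1 e2 e3
  refine e1.trans (e2.le.trans ?_)
  rw [Pi.add_apply, e3]
  exact hdom ω

end PoissonModel

/-! ### Almost sure bounds and laws of large numbers in the model -/

namespace PoissonModel

variable {Ω : Type*} {m0 : MeasurableSpace Ω} {μ : Measure Ω} [IsFiniteMeasure μ]
  {ℱ : Filtration ℕ m0} {θ₀ : Param} {L : Ω → ℝ} {N : Ω → ℕ → ℕ} {δ ρ B : ℝ}

/-- Almost surely, the intensities are bounded in mean square. -/
lemma ae_sum_intensity_sq_le (h : PoissonModel μ ℱ θ₀ L N) (hb : CoefBound δ ρ B θ₀)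
    (hδ : 0 < δ) (hθ : θ₀.2 ∈ bigTheta) {K : ℝ} (hK : ∀ᵐ ω ∂μ, L ω ≤ K) :
    ∀ᵐ ω ∂μ, ∃ C, ∀ n : ℕ, ∑ i ∈ Finset.range n, traj θ₀ (L ω) (N ω) i ^ 2 ≤ C * n := by
  obtain ⟨u, hu, hdrift⟩ := exists_exp_drift hθ
  obtain ⟨c₁, C₁, hc₁, hC₁, h1, h1'⟩ := hdrift u hu le_rfl
  -- The strong law is applied to `exp (uΛ/2)`, whose second moments are the exponential moments at
  -- `u`; the drift at `u/2` then bounds its averages.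
  obtain ⟨c, C', hc, hC', h2, h2'⟩ := hdrift (u / 2) (by positivity) (by linarith)
  obtain ⟨M₁, hM₁⟩ := h.exists_exp_moment hb hδ hK hu hc₁ hC₁ h1 h1'
  obtain ⟨M, hM⟩ := h.exists_exp_moment hb hδ hK (by positivity) hc hC' h2 h2'
  have hsq : ∀ i ω, Real.exp (u / 2 * traj θ₀ (L ω) (N ω) i) ^ 2
      = Real.exp (u * traj θ₀ (L ω) (N ω) i) := by
    intro i ω
    rw [← Real.exp_nat_mul]
    congr 1
    push_cast
    ring
  have hlln := tendsto_avg_sub_condExp (μ := μ) (ℱ := ℱ) (C := M₁)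
    (U := fun i ω => Real.exp (u / 2 * traj θ₀ (L ω) (N ω) (i + 1)))
    (fun i => ((by fun_prop : Measurable fun x : ℝ => Real.exp (u / 2 * x)).comp
      (h.measurable_traj θ₀ h.init_meas (i + 1))).stronglyMeasurable)
    (fun i => by
      rw [memLp_two_iff_integrable_sq (hM (i + 1)).1.1]
      simpa only [hsq] using (hM₁ (i + 1)).1)
    (fun i => by simpa only [hsq] using (hM₁ (i + 1)).2)
  have hcond := ae_all_iff.2 fun i => h.condExp_exp_succ_le hb hδ (by positivity) hc h2 h2'
    (hM i).1 (hM (i + 1)).1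
  filter_upwards [hlln, hcond] with ω hω hω'
  obtain ⟨E, hE⟩ := hω.bddAbove_range
  set V : ℕ → ℝ := fun i => Real.exp (u / 2 * traj θ₀ (L ω) (N ω) i) with hV
  have hV0 : ∀ i, 0 < V i := fun i => Real.exp_pos _
  have hsumV : ∀ n : ℕ, 1 ≤ n → ∑ i ∈ Finset.range n, V i ≤ 2 * (V 0 + C' + E) * n := by
    intro n hn
    have hn1 : (1 : ℝ) ≤ n := by exact_mod_cast hn
    have e1 : (∑ i ∈ Finset.range n, (V (i + 1)
        - μ[fun ω => Real.exp (u / 2 * traj θ₀ (L ω) (N ω) (i + 1)) | ℱ i] ω)) / n ≤ E :=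
      hE ⟨n, rfl⟩
    rw [div_le_iff₀ (by linarith)] at e1
    have e2 : ∑ i ∈ Finset.range n, (V (i + 1) - (1 / 2 * V i + C')) ≤ E * n :=
      (Finset.sum_le_sum fun i _ => sub_le_sub_left (hω' i) _).trans e1
    rw [Finset.sum_sub_distrib, Finset.sum_add_distrib, ← Finset.mul_sum, Finset.sum_const,
      Finset.card_range, nsmul_eq_mul] at e2
    have e3 := Finset.sum_range_succ' V n
    rw [Finset.sum_range_succ] at e3
    nlinarith [hV0 n, mul_le_mul_of_nonneg_left hn1 (hV0 0).le]
  -- From `x²/2 ≤ exp x` at `x = uΛ/2`.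
  refine ⟨8 / u ^ 2 * (2 * (V 0 + C' + E)), fun n => ?_⟩
  rcases Nat.eq_zero_or_pos n with rfl | hn
  · simp
  have hsqV : ∀ i, traj θ₀ (L ω) (N ω) i ^ 2 ≤ 8 / u ^ 2 * V i := by
    intro i
    have hT := traj_pos hb hδ (h.init_pos ω) (N ω) i
    have := Real.pow_div_factorial_le_exp (u / 2 * traj θ₀ (L ω) (N ω) i) (by positivity) 2
    rw [div_mul_eq_mul_div, le_div_iff₀ (by positivity)]
    norm_num [Nat.factorial] at this
    simp only [hV]
    nlinarith
  calc ∑ i ∈ Finset.range n, traj θ₀ (L ω) (N ω) i ^ 2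
      ≤ ∑ i ∈ Finset.range n, 8 / u ^ 2 * V i := Finset.sum_le_sum fun i _ => hsqV i
    _ = 8 / u ^ 2 * ∑ i ∈ Finset.range n, V i := by rw [Finset.mul_sum]
    _ ≤ 8 / u ^ 2 * (2 * (V 0 + C' + E) * n) := by gcongr; exact hsumV n hn
    _ = _ := by ring

/-- Since both count coefficients are at least `δ`, a count is at most the next intensity divided by
`δ`, and so inherits its exponential moments. -/
lemma exists_count_fourth_moment (h : PoissonModel μ ℱ θ₀ L N) (hb : CoefBound δ ρ B θ₀)
    (hδ : 0 < δ) (hθ : θ₀.2 ∈ bigTheta) {K : ℝ} (hK : ∀ᵐ ω ∂μ, L ω ≤ K) :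
    ∃ M, ∀ i, Integrable (fun ω => (N ω i : ℝ) ^ 4) μ ∧ ∫ ω, (N ω i : ℝ) ^ 4 ∂μ ≤ M := by
  obtain ⟨u, hu, hdrift⟩ := exists_exp_drift hθ
  obtain ⟨c, C', hc, hC', h1, h1'⟩ := hdrift u hu le_rfl
  obtain ⟨M, hM⟩ := h.exists_exp_moment hb hδ hK hu hc hC' h1 h1'
  have hle : ∀ i ω, (N ω i : ℝ) ^ 4
      ≤ 24 / (u * δ) ^ 4 * Real.exp (u * traj θ₀ (L ω) (N ω) (i + 1)) := by
    intro i ω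
    have hT := traj_pos hb hδ (h.init_pos ω) (N ω) i
    have e1 : δ * N ω i ≤ traj θ₀ (L ω) (N ω) (i + 1) := mul_count_le_intensity hb hδ _ hT.le
    have e2 := Real.pow_div_factorial_le_exp (u * (δ * N ω i)) (by positivity) 4
    have e3 : Real.exp (u * (δ * N ω i)) ≤ Real.exp (u * traj θ₀ (L ω) (N ω) (i + 1)) := by
      gcongr
    have e4 : ((Nat.factorial 4 : ℕ) : ℝ) = 24 := by norm_num [Nat.factorial]
    rw [e4, div_le_iff₀ (by norm_num)] at e2
    rw [div_mul_eq_mul_div, le_div_iff₀ (by positivity), ← mul_pow]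
    calc (N ω i * (u * δ)) ^ 4 = (u * (δ * N ω i)) ^ 4 := by ring
      _ ≤ _ := by linarith
  have hint : ∀ i, Integrable (fun ω => (N ω i : ℝ) ^ 4) μ := by
    intro i
    refine ((hM (i + 1)).1.const_mul (24 / (u * δ) ^ 4)).mono'
      ((h.measurable_count i).pow_const 4).aestronglyMeasurable (ae_of_all _ fun ω => ?_)
    rw [Real.norm_eq_abs, abs_of_nonneg (by positivity)]
    exact hle i ω
  refine ⟨24 / (u * δ) ^ 4 * M, fun i => ⟨hint i, ?_⟩⟩
  refine (integral_mono (hint i) ((hM (i + 1)).1.const_mul _) (hle i)).trans ?_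
  rw [integral_const_mul]
  exact mul_le_mul_of_nonneg_left (hM (i + 1)).2 (by positivity)

/-- Convexity of the fourth power turns the contraction into a recursive inequality for fourth
moments. This order is what the second moments of `N log T` require. -/
lemma exists_traj_fourth_moment (h : PoissonModel μ ℱ θ₀ L N) (hδ : 0 < δ) (hρ : ρ < 1)
    {M : ℝ} (hM : ∀ i, Integrable (fun ω => (N ω i : ℝ) ^ 4) μ ∧ ∫ ω, (N ω i : ℝ) ^ 4 ∂μ ≤ M)
    {θ : Param} (hb : CoefBound δ ρ B θ) {l : ℝ} (hl : 0 < l) :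
    ∃ M', ∀ i, Integrable (fun ω => traj θ l (N ω) i ^ 4) μ ∧
      ∫ ω, traj θ l (N ω) i ^ 4 ∂μ ≤ M' := by
  have hρ0 := hb.rho_pos hδ
  have hB := hb.B_pos hδ
  have h1ρ : 0 < 1 - ρ := by linarith
  set G := (B / (1 - ρ)) ^ 4 * 8 with hG
  have hG0 : 0 < G := by positivity
  have hT : ∀ i ω, 0 < traj θ l (N ω) i := fun i ω => traj_pos hb hδ hl (N ω) i
  have step : ∀ i ω, traj θ l (N ω) (i + 1) ^ 4
      ≤ ρ * traj θ l (N ω) i ^ 4 + (1 - ρ) * (G * (1 + (N ω i : ℝ) ^ 4)) := by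
    intro i ω
    have e1 : traj θ l (N ω) (i + 1) ≤ ρ * traj θ l (N ω) i + B * (1 + N ω i) :=
      intensity_le hb _ (hT i ω).le
    have e2 := pow_le_pow_left₀ (hT (i + 1) ω).le e1 4
    have hx : (0 : ℝ) ≤ B / (1 - ρ) * (1 + N ω i) := by positivity
    have e3 := (convexOn_pow (𝕜 := ℝ) 4).2 (Set.mem_Ici.2 (hT i ω).le) (Set.mem_Ici.2 hx) hρ0.le
      h1ρ.le (by ring)
    simp only [smul_eq_mul] at e3
    have e4 : (1 - ρ) * (B / (1 - ρ) * (1 + (N ω i : ℝ))) = B * (1 + N ω i) := by field_simp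
    rw [e4] at e3
    have e5 : (1 + (N ω i : ℝ)) ^ 4 ≤ 8 * (1 + (N ω i : ℝ) ^ 4) := by
      have := (sq_nonneg (1 - (N ω i : ℝ)))
      have h2 : (1 + (N ω i : ℝ)) ^ 2 ≤ 2 * (1 + (N ω i : ℝ) ^ 2) := by nlinarith
      have h3 := pow_le_pow_left₀ (by positivity) h2 2
      nlinarith [sq_nonneg (1 - (N ω i : ℝ) ^ 2)]
    have e6 : (B / (1 - ρ) * (1 + (N ω i : ℝ))) ^ 4 ≤ G * (1 + (N ω i : ℝ) ^ 4) := by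
      rw [mul_pow, hG, mul_assoc]
      exact mul_le_mul_of_nonneg_left e5 (by positivity)
    exact e2.trans (e3.trans (add_le_add le_rfl (mul_le_mul_of_nonneg_left e6 h1ρ.le)))
  have hm : ∀ i, AEStronglyMeasurable (fun ω => traj θ l (N ω) i ^ 4) μ := fun i =>
    (((h.measurable_traj θ (l := fun _ => l) measurable_const i).mono (ℱ.le i) le_rfl).pow_const
      4).aestronglyMeasurable
  have hM0 : 0 ≤ M := (integral_nonneg fun ω => by positivity).trans (hM 0).2
  refine ⟨l ^ 4 * μ.real Set.univ + G * (μ.real Set.univ + M), fun i => ?_⟩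
  induction i with
  | zero =>
    have : ∀ ω, traj θ l (N ω) 0 ^ 4 = l ^ 4 := fun ω => rfl
    simp only [this]
    refine ⟨integrable_const _, ?_⟩
    rw [integral_const, smul_eq_mul, mul_comm]
    exact le_add_of_nonneg_right (by positivity)
  | succ i ih =>
    have hN1 : Integrable (fun ω => 1 + (N ω i : ℝ) ^ 4) μ := (integrable_const _).add (hM i).1
    have hint' : Integrable
        (fun ω => ρ * traj θ l (N ω) i ^ 4 + (1 - ρ) * (G * (1 + (N ω i : ℝ) ^ 4))) μ :=
      (ih.1.const_mul _).add ((hN1.const_mul _).const_mul _)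
    have hint : Integrable (fun ω => traj θ l (N ω) (i + 1) ^ 4) μ := by
      refine hint'.mono' (hm _) (ae_of_all _ fun ω => ?_)
      rw [Real.norm_eq_abs, abs_of_nonneg (by positivity)]
      exact step i ω
    refine ⟨hint, (integral_mono hint hint' (step i)).trans ?_⟩
    rw [integral_add (ih.1.const_mul _) ((hN1.const_mul _).const_mul _), integral_const_mul,
      integral_const_mul, integral_const_mul, integral_add (integrable_const _) (hM i).1,
      integral_const, smul_eq_mul, mul_one]
    have e1 := mul_le_mul_of_nonneg_left ih.2 hρ0.le
    have e2 := mul_le_mul_of_nonneg_left (hM i).2 (mul_pos h1ρ hG0).le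
    have e3 : 0 ≤ (1 - ρ) * (l ^ 4 * μ.real Set.univ) := by positivity
    nlinarith

/-- Law of large numbers for the martingale part of the log-likelihood. -/
lemma ae_tendsto_noise (h : PoissonModel μ ℱ θ₀ L N) (hb₀ : CoefBound δ ρ B θ₀)
    (hδ : 0 < δ) (hρ : ρ < 1) (hθ : θ₀.2 ∈ bigTheta) {K : ℝ} (hK : ∀ᵐ ω ∂μ, L ω ≤ K)
    {θ : Param} (hb : CoefBound δ ρ B θ) {l : ℝ} (hl : 0 < l) :
    ∀ᵐ ω ∂μ, Tendsto (fun n : ℕ => noise θ l (N ω) (traj θ₀ (L ω) (N ω)) n / n) atTop (𝓝 0) := by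
  obtain ⟨M, hM⟩ := h.exists_count_fourth_moment hb₀ hδ hθ hK
  obtain ⟨M', hM'⟩ := h.exists_traj_fourth_moment hδ hρ hM hb hl
  set m := min δ l with hm
  have hm0 : 0 < m := lt_min hδ hl
  have hTm : ∀ i, Measurable[ℱ i] fun ω => traj θ l (N ω) i := fun i =>
    h.measurable_traj θ (l := fun _ => l) measurable_const i
  have hlogm : ∀ i, Measurable[ℱ i] fun ω => Real.log (traj θ l (N ω) i) := fun i =>
    Real.measurable_log.comp (hTm i)
  have hNm : ∀ i, Measurable[ℱ (i + 1)] fun ω => (N ω i : ℝ) := fun i =>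
    (measurable_from_top (f := fun k : ℕ => (k : ℝ))).comp (h.count_meas i)
  have hlog : ∀ i ω, Real.log (traj θ l (N ω) i) ^ 4
      ≤ 8 * (traj θ l (N ω) i ^ 4 + Real.log m ^ 4) := by
    intro i ω
    have hT : 0 < traj θ l (N ω) i := traj_pos hb hδ hl (N ω) i
    have e1 : Real.log (traj θ l (N ω) i) ≤ traj θ l (N ω) i := Real.log_le_self hT.le
    have e2 : Real.log m ≤ Real.log (traj θ l (N ω) i) :=
      Real.log_le_log hm0 (min_le_traj hb hδ hl (N ω) i)
    set x := Real.log (traj θ l (N ω) i)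
    set t := traj θ l (N ω) i
    -- Either `0 ≤ x ≤ t` or `log m ≤ x ≤ 0`.
    have e3 : x ^ 2 ≤ t ^ 2 + Real.log m ^ 2 := by
      rcases le_total 0 x with hx | hx
      · nlinarith [sq_nonneg (Real.log m)]
      · nlinarith [sq_nonneg t]
    have e4 := pow_le_pow_left₀ (sq_nonneg x) e3 2
    nlinarith [sq_nonneg (t ^ 2 - Real.log m ^ 2), sq_nonneg (t ^ 2), sq_nonneg (Real.log m ^ 2)]
  have hdom : ∀ i ω, (Real.log (traj θ l (N ω) i) * N ω i) ^ 2
      ≤ (N ω i : ℝ) ^ 4 + 8 * (traj θ l (N ω) i ^ 4 + Real.log m ^ 4) := by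
    intro i ω
    have := hlog i ω
    nlinarith [sq_nonneg (Real.log (traj θ l (N ω) i) ^ 2 - (N ω i : ℝ) ^ 2),
      sq_nonneg ((N ω i : ℝ) ^ 2), sq_nonneg (Real.log (traj θ l (N ω) i) ^ 2)]
  have hUm : ∀ i, Measurable[ℱ (i + 1)] fun ω => Real.log (traj θ l (N ω) i) * (N ω i : ℝ) :=
    fun i => ((hlogm i).mono (ℱ.mono i.le_succ) le_rfl).mul (hNm i)
  have hTc : ∀ i, Integrable (fun ω => traj θ l (N ω) i ^ 4 + Real.log m ^ 4) μ := fun i =>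
    (hM' i).1.add (integrable_const _)
  have hdomint : ∀ i, Integrable
      (fun ω => (N ω i : ℝ) ^ 4 + 8 * (traj θ l (N ω) i ^ 4 + Real.log m ^ 4)) μ := fun i =>
    (hM i).1.add ((hTc i).const_mul _)
  have hU2int : ∀ i, Integrable (fun ω => (Real.log (traj θ l (N ω) i) * (N ω i : ℝ)) ^ 2) μ := by
    intro i
    refine (hdomint i).mono'
      (((hUm i).mono (ℱ.le _) le_rfl).pow_const 2).aestronglyMeasurable (ae_of_all _ fun ω => ?_)
    rw [Real.norm_eq_abs, abs_of_nonneg (sq_nonneg _)]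
    exact hdom i ω
  have hU2 : ∀ i, MemLp (fun ω => Real.log (traj θ l (N ω) i) * (N ω i : ℝ)) 2 μ := fun i =>
    (memLp_two_iff_integrable_sq ((hUm i).mono (ℱ.le _) le_rfl).aestronglyMeasurable).2 (hU2int i)
  have hlln := tendsto_avg_sub_condExp (μ := μ) (ℱ := ℱ)
    (C := M + 8 * (M' + μ.real Set.univ * Real.log m ^ 4))
    (U := fun i ω => Real.log (traj θ l (N ω) i) * (N ω i : ℝ))
    (fun i => (hUm i).stronglyMeasurable) hU2 (fun i => by
      refine (integral_mono (hU2int i) (hdomint i) (hdom i)).trans ?_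
      rw [integral_add (hM i).1 ((hTc i).const_mul _), integral_const_mul,
        integral_add (hM' i).1 (integrable_const _), integral_const, smul_eq_mul]
      linarith [(hM i).2, (hM' i).2])
  have hNint : ∀ i, Integrable (fun ω => (N ω i : ℝ)) μ := by
    intro i
    refine ((integrable_const (1 : ℝ)).add (hM i).1).mono'
      ((hNm i).mono (ℱ.le _) le_rfl).aestronglyMeasurable (ae_of_all _ fun ω => ?_)
    rw [Real.norm_eq_abs, abs_of_nonneg (Nat.cast_nonneg _), Pi.add_apply]
    nlinarith [sq_nonneg ((N ω i : ℝ) ^ 2 - 1), sq_nonneg ((N ω i : ℝ) - 1)]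
  have hcond := ae_all_iff.2 fun i => h.condExp_mul_count hb₀ hδ (f := fun k => (k : ℝ))
    (v := fun l => l) (fun k => Nat.cast_nonneg k) hasSum_mul_poissonWeight measurable_id
    (hNint i) (hlogm i) ((hU2 i).integrable one_le_two)
  filter_upwards [hlln, hcond] with ω hω hω'
  refine hω.congr fun n => ?_
  unfold noise
  congr 1
  refine Finset.sum_congr rfl fun i _ => ?_
  rw [hω' i]
  ring

/-- Law of large numbers for the occurrences of a given count at predictable times. -/
lemma ae_tendsto_avg_count_eq (h : PoissonModel μ ℱ θ₀ L N) (hb₀ : CoefBound δ ρ B θ₀)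
    (hδ : 0 < δ) {Z : ℕ → Ω → ℝ} (hZm : ∀ i, Measurable[ℱ i] (Z i)) (hZ0 : ∀ i ω, 0 ≤ Z i ω)
    (hZ1 : ∀ i ω, Z i ω ≤ 1) (y : ℕ) :
    ∀ᵐ ω ∂μ, Tendsto (fun n : ℕ => (∑ i ∈ Finset.range n, Z i ω *
      ((if N ω i = y then 1 else 0) - poissonWeight (traj θ₀ (L ω) (N ω) i) y)) / n)
      atTop (𝓝 0) := by
  set f : ℕ → ℝ := fun k => if k = y then 1 else 0 with hf
  have hf0 : ∀ k, 0 ≤ f k := fun k => by simp only [hf]; split_ifs <;> norm_num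
  have hf1 : ∀ k, f k ≤ 1 := fun k => by simp only [hf]; split_ifs <;> norm_num
  have hfm : ∀ i, Measurable[ℱ (i + 1)] fun ω => f (N ω i) := fun i =>
    (measurable_from_top (f := f)).comp (h.count_meas i)
  have hUm : ∀ i, Measurable[ℱ (i + 1)] fun ω => Z i ω * f (N ω i) := fun i =>
    ((hZm i).mono (ℱ.mono i.le_succ) le_rfl).mul (hfm i)
  have hU0 : ∀ i ω, 0 ≤ Z i ω * f (N ω i) := fun i ω => mul_nonneg (hZ0 i ω) (hf0 _)
  have hU1 : ∀ i ω, Z i ω * f (N ω i) ≤ 1 := fun i ω =>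
    mul_le_one₀ (hZ1 i ω) (hf0 _) (hf1 _)
  have hU2 : ∀ i, MemLp (fun ω => Z i ω * f (N ω i)) 2 μ := fun i =>
    MemLp.of_bound ((hUm i).mono (ℱ.le _) le_rfl).aestronglyMeasurable 1 (ae_of_all _ fun ω => by
      rw [Real.norm_eq_abs, abs_of_nonneg (hU0 i ω)]; exact hU1 i ω)
  have hlln := tendsto_avg_sub_condExp (μ := μ) (ℱ := ℱ) (C := μ.real Set.univ)
    (U := fun i ω => Z i ω * f (N ω i)) (fun i => (hUm i).stronglyMeasurable) hU2 (fun i => by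
      refine (integral_mono (hU2 i).integrable_sq (integrable_const (1 : ℝ)) fun ω =>
        pow_le_one₀ (hU0 i ω) (hU1 i ω)).trans ?_
      simp)
  have hfint : ∀ i, Integrable (fun ω => f (N ω i)) μ := fun i =>
    Integrable.of_bound ((hfm i).mono (ℱ.le _) le_rfl).aestronglyMeasurable 1
      (ae_of_all _ fun ω => by rw [Real.norm_eq_abs, abs_of_nonneg (hf0 _)]; exact hf1 _)
  have hcond := ae_all_iff.2 fun i => h.condExp_mul_count hb₀ hδ (v := fun l => poissonWeight l y)
    hf0 (fun l => hasSum_indicator_poissonWeight l y) (measurable_poissonWeight y)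
    (hfint i) (hZm i) ((hU2 i).integrable one_le_two)
  filter_upwards [hlln, hcond] with ω hω hω'
  refine hω.congr fun n => ?_
  congr 1
  refine Finset.sum_congr rfl fun i _ => ?_
  rw [hω' i]
  ring

end PoissonModel

/-! ### Frequency of pairs of consecutive counts -/

section Frequency

/-- The strong law replaces the indicator `e` by its conditional probability `q`, which is at least
`p` wherever the weight is nonzero; half of the resulting rate absorbs the error. -/
lemma eventually_le_sum_mul {w e q : ℕ → ℝ} {p c : ℝ} (hw : ∀ i, 0 ≤ w i)
    (hq : ∀ i, w i ≠ 0 → p ≤ q i) (hp : 0 < p) (hc : 0 < c)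
    (hsum : ∀ᶠ n : ℕ in atTop, c * n ≤ ∑ i ∈ Finset.range n, w i)
    (hlln : Tendsto (fun n : ℕ => (∑ i ∈ Finset.range n, w i * (e i - q i)) / n) atTop (𝓝 0)) :
    ∀ᶠ n : ℕ in atTop, p * c / 2 * n ≤ ∑ i ∈ Finset.range n, w i * e i := by
  have h0 : -(p * c / 2) < 0 := by
    have : 0 < p * c := by positivity
    linarith
  filter_upwards [hsum, hlln.eventually (lt_mem_nhds h0), eventually_gt_atTop 0] with n h1 h2 hn
  have hn0 : (0 : ℝ) < n := by exact_mod_cast hn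
  rw [lt_div_iff₀ hn0] at h2
  have h3 : p * ∑ i ∈ Finset.range n, w i ≤ ∑ i ∈ Finset.range n, w i * q i := by
    rw [Finset.mul_sum]
    refine Finset.sum_le_sum fun i _ => ?_
    rcases eq_or_ne (w i) 0 with h | h
    · simp [h]
    · rw [mul_comm]
      exact mul_le_mul_of_nonneg_left (hq i h) (hw i)
  have h4 : ∑ i ∈ Finset.range n, w i * e i
      = ∑ i ∈ Finset.range n, w i * (e i - q i) + ∑ i ∈ Finset.range n, w i * q i := by
    rw [← Finset.sum_add_distrib]
    exact Finset.sum_congr rfl fun i _ => by ring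
  have h5 := mul_le_mul_of_nonneg_left h1 hp.le
  rw [h4]
  nlinarith

open scoped Classical in
/-- The indicator that the count preceding time `i` equals `y` and arose at intensity at most
`K`. -/
def precededBy (Λ : ℕ → ℝ) (N : ℕ → ℕ) (K : ℝ) (y : ℕ) : ℕ → ℝ
  | 0 => 0
  | i + 1 => if Λ i ≤ K ∧ N i = y then 1 else 0

lemma precededBy_nonneg (Λ : ℕ → ℝ) (N : ℕ → ℕ) (K : ℝ) (y i : ℕ) :
    0 ≤ precededBy Λ N K y i := by
  cases i with
  | zero => exact le_rfl
  | succ i => simp only [precededBy]; split_ifs <;> norm_num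

lemma precededBy_le_one (Λ : ℕ → ℝ) (N : ℕ → ℕ) (K : ℝ) (y i : ℕ) :
    precededBy Λ N K y i ≤ 1 := by
  cases i with
  | zero => exact zero_le_one
  | succ i => simp only [precededBy]; split_ifs <;> norm_num

/-- All pairs of consecutive counts occur with positive lower frequency at bounded intensities. -/
lemma exists_pattern_frequency {δ ρ B : ℝ} {θ₀ : Param} (hb : CoefBound δ ρ B θ₀) (hδ : 0 < δ)
    {l₀ : ℝ} (hl₀ : 0 < l₀) {N : ℕ → ℕ} {C : ℝ}
    (hΛ : ∀ n, ∑ i ∈ Finset.range n, traj θ₀ l₀ N i ^ 2 ≤ C * n)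
    (h1 : ∀ K y : ℕ, Tendsto (fun n : ℕ => (∑ i ∈ Finset.range n,
      (if traj θ₀ l₀ N i ≤ K then (1 : ℝ) else 0) *
        ((if N i = y then 1 else 0) - poissonWeight (traj θ₀ l₀ N i) y)) / n) atTop (𝓝 0))
    (h2 : ∀ K y' y : ℕ, Tendsto (fun n : ℕ => (∑ i ∈ Finset.range n,
      precededBy (traj θ₀ l₀ N) N K y' i *
        ((if N i = y then 1 else 0) - poissonWeight (traj θ₀ l₀ N i) y)) / n) atTop (𝓝 0)) :
    ∃ K : ℝ, ∀ y' y : ℕ, ∃ c : ℝ, 0 < c ∧ ∀ᶠ n : ℕ in atTop, c * n ≤ ((Finset.range n).filter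
      (fun i => traj θ₀ l₀ N i ≤ K ∧ N i = y' ∧ N (i + 1) = y)).card := by
  set Λ := traj θ₀ l₀ N with hΛdef
  have hm : 0 < min δ l₀ := lt_min hδ hl₀
  have hmΛ : ∀ i, min δ l₀ ≤ Λ i := min_le_traj hb hδ hl₀ N
  -- `K > 1` gives `K ≤ Λ²` whenever `Λ > K`, and `K > 2C` then makes such times at most half of
  -- all. The same `K` serves every pattern.
  obtain ⟨K, hK⟩ := exists_nat_gt (max (2 * C) 1)
  have hKC : 2 * C < K := (le_max_left _ _).trans_lt hK
  have hK1 : (1 : ℝ) < K := (le_max_right _ _).trans_lt hK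
  refine ⟨K, fun y' y => ?_⟩
  have hA : ∀ᶠ n : ℕ in atTop,
      (1 / 2 : ℝ) * n ≤ ∑ i ∈ Finset.range n, (if Λ i ≤ K then (1 : ℝ) else 0) := by
    refine Eventually.of_forall fun n => ?_
    have e1 : ∀ i, (K : ℝ) * (1 - (if Λ i ≤ K then (1 : ℝ) else 0)) ≤ Λ i ^ 2 := by
      intro i
      split_ifs with h
      · simpa using sq_nonneg _
      · push Not at h
        nlinarith
    have e2 := (Finset.sum_le_sum fun i (_ : i ∈ Finset.range n) => e1 i).trans (hΛ n)
    rw [← Finset.mul_sum, Finset.sum_sub_distrib, Finset.sum_const, Finset.card_range,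
      nsmul_eq_mul, mul_one] at e2
    have hn : (0 : ℝ) ≤ n := Nat.cast_nonneg n
    by_contra! hlt
    nlinarith [mul_lt_mul_of_pos_left hlt (by linarith : (0 : ℝ) < K),
      mul_le_mul_of_nonneg_right hKC.le hn]
  have hp : 0 < Real.exp (-(K : ℝ)) * min δ l₀ ^ y' / y'.factorial := by positivity
  have hB := eventually_le_sum_mul (w := fun i => if Λ i ≤ K then (1 : ℝ) else 0)
    (e := fun i => if N i = y' then 1 else 0) (q := fun i => poissonWeight (Λ i) y')
    (fun i => by split_ifs <;> norm_num)
    (fun i hi => le_poissonWeight hm.le (hmΛ i) (by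
      by_contra h
      exact hi (if_neg h)) y') hp one_half_pos hA (h1 K y')
  set c₁ := Real.exp (-(K : ℝ)) * min δ l₀ ^ y' / y'.factorial * (1 / 2) / 2 with hc₁
  have hc₁0 : 0 < c₁ := by positivity
  -- `precededBy` is delayed by one step so as to be predictable; halving `c₁` pays for the lost
  -- index.
  have hB' : ∀ᶠ n : ℕ in atTop,
      c₁ / 2 * n ≤ ∑ i ∈ Finset.range n, precededBy Λ N K y' i := by
    filter_upwards [(tendsto_sub_atTop_nat 1).eventually hB, eventually_ge_atTop 2] with n hn hn2
    obtain ⟨k, rfl⟩ : ∃ k, n = k + 1 := ⟨n - 1, by omega⟩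
    rw [Nat.add_sub_cancel] at hn
    rw [Finset.sum_range_succ']
    have hk : (1 : ℝ) ≤ k := by exact_mod_cast (by omega : 1 ≤ k)
    have e1 : ∑ i ∈ Finset.range k, (if Λ i ≤ K then (1 : ℝ) else 0) * (if N i = y' then 1 else 0)
        = ∑ i ∈ Finset.range k, precededBy Λ N K y' (i + 1) := by
      refine Finset.sum_congr rfl fun i _ => ?_
      unfold precededBy
      by_cases h : Λ i ≤ K <;> by_cases h' : N i = y' <;> simp [h, h']
    rw [e1] at hn
    have e2 : precededBy Λ N K y' 0 = 0 := rfl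
    rw [e2, add_zero]
    push_cast
    nlinarith
  -- Bounds the intensity that follows the count `y'` arising at intensity at most `K`, hence bounds
  -- the next Poisson weight from below.
  set K₂ := ρ * K + B * (1 + y') with hK₂
  have hp₂ : 0 < Real.exp (-K₂) * min δ l₀ ^ y / y.factorial := by positivity
  have hCev := eventually_le_sum_mul (w := precededBy Λ N K y')
    (e := fun i => if N i = y then 1 else 0) (q := fun i => poissonWeight (Λ i) y)
    (precededBy_nonneg _ _ _ _) (fun i hi => by
      cases i with
      | zero => exact absurd rfl hi
      | succ i =>
        have hi' : Λ i ≤ K ∧ N i = y' := by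
          by_contra h
          exact hi (if_neg h)
        refine le_poissonWeight hm.le (hmΛ _) ?_ y
        refine (intensity_le hb (N i) (hm.le.trans (hmΛ i))).trans ?_
        rw [hi'.2, hK₂]
        have := mul_le_mul_of_nonneg_left hi'.1 (hb.rho_pos hδ).le
        linarith) hp₂ (half_pos hc₁0) hB' (h2 K y' y)
  refine ⟨Real.exp (-K₂) * min δ l₀ ^ y / y.factorial * (c₁ / 2) / 2, by positivity, ?_⟩
  filter_upwards [hCev, eventually_ge_atTop 1] with n hn hn1
  refine hn.trans ?_
  obtain ⟨k, rfl⟩ : ∃ k, n = k + 1 := ⟨n - 1, by omega⟩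
  rw [Finset.sum_range_succ']
  have e2 : precededBy Λ N K y' 0 = 0 := rfl
  rw [e2, zero_mul, add_zero]
  have e3 : ∀ i, precededBy Λ N K y' (i + 1) * (if N (i + 1) = y then (1 : ℝ) else 0)
      = if Λ i ≤ K ∧ N i = y' ∧ N (i + 1) = y then 1 else 0 := by
    intro i
    unfold precededBy
    by_cases h : Λ i ≤ K <;> by_cases h' : N i = y' <;> by_cases h'' : N (i + 1) = y <;>
      simp [h, h', h'']
  rw [Finset.sum_congr rfl fun i _ => e3 i, Finset.sum_boole]
  exact_mod_cast Finset.card_le_card (Finset.filter_subset_filter _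
    (Finset.range_subset_range.2 k.le_succ))

lemma sum_count_sq_le {δ ρ B : ℝ} {θ₀ : Param} (hb : CoefBound δ ρ B θ₀) (hδ : 0 < δ)
    {l₀ : ℝ} (hl₀ : 0 ≤ l₀) {N : ℕ → ℕ} {C : ℝ}
    (hΛ : ∀ n, ∑ i ∈ Finset.range n, traj θ₀ l₀ N i ^ 2 ≤ C * n) (n : ℕ) :
    ∑ i ∈ Finset.range n, (N i : ℝ) ^ 2 ≤ 2 * C / δ ^ 2 * n := by
  rcases Nat.eq_zero_or_pos n with rfl | hn
  · simp
  have hn1 : (1 : ℝ) ≤ n := by exact_mod_cast hn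
  have hC : 0 ≤ C := by
    have := (Finset.sum_nonneg fun i _ => sq_nonneg (traj θ₀ l₀ N i)).trans (hΛ 1)
    simpa using this
  have e1 : ∀ i, (δ * N i) ^ 2 ≤ traj θ₀ l₀ N (i + 1) ^ 2 := fun i =>
    pow_le_pow_left₀ (by positivity) (mul_count_le_intensity hb hδ _ (traj_nonneg hb hδ hl₀ N i)) 2
  have e2 := Finset.sum_le_sum fun i (_ : i ∈ Finset.range n) => e1 i
  have e3 := Finset.sum_range_succ' (fun i => traj θ₀ l₀ N i ^ 2) n
  have e4 := hΛ (n + 1)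
  push_cast at e4
  simp only [mul_pow] at e2
  rw [← Finset.mul_sum] at e2
  rw [div_mul_eq_mul_div, le_div_iff₀ (by positivity)]
  nlinarith [sq_nonneg (traj θ₀ l₀ N 0), mul_le_mul_of_nonneg_left hn1 hC]

end Frequency

/-! ### Uniform constants from compactness -/

section Constants

lemma exists_coefBound {D : Set Coef} (hD : IsCompact D) (hDΘ : D ⊆ bigTheta) :
    ∃ δ ρ B : ℝ, 0 < δ ∧ ρ < 1 ∧ ∀ θ : Param, θ.2 ∈ D → CoefBound δ ρ B θ := by
  rcases D.eq_empty_or_nonempty with rfl | hne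
  · exact ⟨1, 0, 0, one_pos, zero_lt_one, fun θ hθ => hθ.elim⟩
  have hcont : ∀ i, ContinuousOn (fun x : Coef => x i) D := fun i => by fun_prop
  choose xm hxm hmin using fun i => hD.exists_isMinOn hne (hcont i)
  choose xM hxM hmax using fun i => hD.exists_isMaxOn hne (hcont i)
  refine ⟨Finset.univ.inf' Finset.univ_nonempty fun i => xm i i, max (xM 1 1) (xM 4 4),
    Finset.univ.sup' Finset.univ_nonempty fun i => xM i i, ?_, ?_, fun θ hθ => ?_⟩
  · rw [Finset.lt_inf'_iff]
    exact fun i _ => (hDΘ (hxm i)).1 i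
  · have h4 := hDΘ (hxM 4)
    exact max_lt (hDΘ (hxM 1)).2.1 (by linarith [h4.1 5, h4.2.2.2])
  · exact ⟨fun i => (Finset.inf'_le _ (Finset.mem_univ i)).trans (hmin i hθ),
      fun i => (hmax i hθ).trans (Finset.le_sup' (fun i => xM i i) (Finset.mem_univ i)),
      (hmax 1 hθ).trans (le_max_left _ _), (hmax 4 hθ).trans (le_max_right _ _)⟩

lemma isCompact_paramSpace (rstar : ℕ) {D : Set Coef} (hD : IsCompact D) :
    IsCompact (paramSpace rstar D) :=
  (Set.finite_Iic rstar).isCompact.prod hD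

end Constants

/-! ### Almost sure convergence in the model -/

namespace PoissonModel

variable {Ω : Type*} {m0 : MeasurableSpace Ω} {μ : Measure Ω}
  {ℱ : Filtration ℕ m0} {θ₀ : Param} {L : Ω → ℝ} {N : Ω → ℕ → ℕ} {δ ρ B : ℝ}

/-- Restricting to an event of `ℱ 0` leaves the conditional laws unchanged. The total mass may drop,
which is why the estimates are made for finite measures. -/
lemma restrict (h : PoissonModel μ ℱ θ₀ L N) {A : Set Ω} (hA : MeasurableSet[ℱ 0] A) :
    PoissonModel (μ.restrict A) ℱ θ₀ L N where
  count_meas := h.count_meas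
  init_meas := h.init_meas
  init_pos := h.init_pos
  law i k S hS := by
    have hA' := ℱ.mono (Nat.zero_le i) A hA
    have hms : MeasurableSet (S ∩ {ω | N ω i = k}) :=
      (ℱ.le i S hS).inter (ℱ.le _ _ (h.measurableSet_count i k))
    rw [Measure.restrict_apply hms, Measure.restrict_restrict (ℱ.le i S hS),
      Set.inter_right_comm]
    exact h.law i k (S ∩ A) (MeasurableSet.inter hS hA')

/-- Almost sure convergence of maximum likelihood estimates to the set of parameters defining the
same recursion, for a bounded initial intensity. -/
lemma ae_tendsto_infDist_of_bounded (h : PoissonModel μ ℱ θ₀ L N) [IsFiniteMeasure μ]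
    {rstar : ℕ} {D : Set Coef} (hD : IsCompact D) (hDΘ : D ⊆ bigTheta)
    (hθ₀ : θ₀ ∈ paramSpace rstar D) {K : ℝ} (hK : ∀ᵐ ω ∂μ, L ω ≤ K) {l₁ : ℝ} (hl₁ : 0 < l₁)
    {y : Ω → ℕ → ℕ} (hNy : ∀ ω, N ω = fun i => y ω (i + 1)) {θhat : ℕ → Ω → Param}
    (hhat : ∀ᵐ ω ∂μ, ∀ n, 1 ≤ n → IsMLE (paramSpace rstar D) l₁ (y ω) n (θhat n ω)) :
    ∀ᵐ ω ∂μ, Tendsto (fun n => Metric.infDist (θhat n ω) (sameModel (paramSpace rstar D) θ₀))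
      atTop (𝓝 0) := by
  obtain ⟨δ, ρ, B, hδ, hρ, hbound⟩ := exists_coefBound hD hDΘ
  have hS : ∀ θ ∈ paramSpace rstar D, CoefBound δ ρ B θ := fun θ hθ => hbound θ hθ.2
  have hb₀ := hS θ₀ hθ₀
  have hScpt := isCompact_paramSpace rstar hD
  -- Countability permits a single null set for the noise; the Lipschitz bound extends the limit to
  -- all parameters. For the same reason the levels `K` below are natural numbers.
  obtain ⟨Q, hQS, hQc, hSQ⟩ := hScpt.isSeparable.exists_countable_dense_subset
  have hnoise : ∀ᵐ ω ∂μ, ∀ θ ∈ Q,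
      Tendsto (fun n : ℕ => noise θ l₁ (N ω) (traj θ₀ (L ω) (N ω)) n / n) atTop (𝓝 0) :=
    (ae_ball_iff hQc).2 fun θ hθ =>
      h.ae_tendsto_noise hb₀ hδ hρ (hDΘ hθ₀.2) hK (hS θ (hQS hθ)) hl₁
  have hΛm := fun i => h.measurable_traj θ₀ h.init_meas i
  have h1 : ∀ᵐ ω ∂μ, ∀ K y : ℕ, Tendsto (fun n : ℕ => (∑ i ∈ Finset.range n,
      (if traj θ₀ (L ω) (N ω) i ≤ K then (1 : ℝ) else 0) *
        ((if N ω i = y then 1 else 0) - poissonWeight (traj θ₀ (L ω) (N ω) i) y)) / n)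
        atTop (𝓝 0) := by
    refine ae_all_iff.2 fun K => ae_all_iff.2 fun y => ?_
    refine h.ae_tendsto_avg_count_eq hb₀ hδ
      (Z := fun i ω => if traj θ₀ (L ω) (N ω) i ≤ K then (1 : ℝ) else 0)
      (fun i => ?_) (fun i ω => by split_ifs <;> norm_num)
      (fun i ω => by split_ifs <;> norm_num) y
    exact (Measurable.ite measurableSet_Iic measurable_const measurable_const :
      Measurable fun x : ℝ => if x ≤ K then (1 : ℝ) else 0).comp (hΛm i)
  have h2 : ∀ᵐ ω ∂μ, ∀ K y' y : ℕ, Tendsto (fun n : ℕ => (∑ i ∈ Finset.range n,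
      precededBy (traj θ₀ (L ω) (N ω)) (N ω) K y' i *
        ((if N ω i = y then 1 else 0) - poissonWeight (traj θ₀ (L ω) (N ω) i) y)) / n)
        atTop (𝓝 0) := by
    refine ae_all_iff.2 fun K => ae_all_iff.2 fun y' => ae_all_iff.2 fun y => ?_
    refine h.ae_tendsto_avg_count_eq hb₀ hδ
      (Z := fun i ω => precededBy (traj θ₀ (L ω) (N ω)) (N ω) K y' i)
      (fun i => ?_) (fun i ω => precededBy_nonneg _ _ _ _ _)
      (fun i ω => precededBy_le_one _ _ _ _ _) y
    cases i with
    | zero => exact measurable_const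
    | succ i =>
      have hset : MeasurableSet {p : ℝ × ℕ | p.1 ≤ K ∧ p.2 = y'} :=
        (measurable_fst measurableSet_Iic).inter (measurable_snd (measurableSet_singleton y'))
      have hg : Measurable fun p : ℝ × ℕ => if p.1 ≤ K ∧ p.2 = y' then (1 : ℝ) else 0 :=
        Measurable.ite hset measurable_const measurable_const
      have := hg.comp (((hΛm i).mono (ℱ.mono i.le_succ) le_rfl).prodMk (h.count_meas i))
      convert this using 2
      simp [precededBy]
  filter_upwards [hhat, hnoise, h1, h2, h.ae_sum_intensity_sq_le hb₀ hδ (hDΘ hθ₀.2) hK]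
    with ω hmle hn h1 h2 hsq
  obtain ⟨C, hC⟩ := hsq
  have hL := h.init_pos ω
  have hN := sum_count_sq_le hb₀ hδ hL.le hC
  obtain ⟨K', hpat⟩ := exists_pattern_frequency hb₀ hδ hL hC h1 h2
  have hN' : ∀ n : ℕ, ∑ i ∈ Finset.range n, (N ω i : ℝ) ^ 2 ≤ max C (2 * C / δ ^ 2) * n :=
    fun n => (hN n).trans (mul_le_mul_of_nonneg_right (le_max_right _ _) (Nat.cast_nonneg n))
  have hC' : ∀ n : ℕ, ∑ i ∈ Finset.range n, traj θ₀ (L ω) (N ω) i ^ 2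
      ≤ max C (2 * C / δ ^ 2) * n :=
    fun n => (hC n).trans (mul_le_mul_of_nonneg_right (le_max_left _ _) (Nat.cast_nonneg n))
  exact tendsto_infDist_of_noise hScpt hS hδ hρ hθ₀ hl₁ hL.le (hNy ω) hN' hC'
    (tendsto_noise_of_dense hδ hρ hl₁ hN' hC' hS hQS hSQ hn) hpat hmle

/-- Localization on the events `L ≤ K`, which belong to `ℱ 0` and exhaust `Ω`, removes the bound on
the initial intensity. -/
lemma ae_tendsto_infDist (h : PoissonModel μ ℱ θ₀ L N) [IsFiniteMeasure μ]
    {rstar : ℕ} {D : Set Coef} (hD : IsCompact D) (hDΘ : D ⊆ bigTheta)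
    (hθ₀ : θ₀ ∈ paramSpace rstar D) {l₁ : ℝ} (hl₁ : 0 < l₁)
    {y : Ω → ℕ → ℕ} (hNy : ∀ ω, N ω = fun i => y ω (i + 1)) {θhat : ℕ → Ω → Param}
    (hhat : ∀ᵐ ω ∂μ, ∀ n, 1 ≤ n → IsMLE (paramSpace rstar D) l₁ (y ω) n (θhat n ω)) :
    ∀ᵐ ω ∂μ, Tendsto (fun n => Metric.infDist (θhat n ω) (sameModel (paramSpace rstar D) θ₀))
      atTop (𝓝 0) := by
  have hA : ∀ K : ℕ, MeasurableSet[ℱ 0] {ω | L ω ≤ K} := fun K => h.init_meas measurableSet_Iic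
  have key : ∀ᵐ ω ∂μ, ∀ K : ℕ, L ω ≤ K → Tendsto (fun n =>
      Metric.infDist (θhat n ω) (sameModel (paramSpace rstar D) θ₀)) atTop (𝓝 0) := by
    refine ae_all_iff.2 fun K => ?_
    have hms : MeasurableSet {ω | L ω ≤ K} := ℱ.le 0 _ (hA K)
    exact (ae_restrict_iff' hms).1 ((h.restrict (hA K)).ae_tendsto_infDist_of_bounded hD hDΘ hθ₀
      (ae_restrict_mem hms) hl₁ hNy (ae_restrict_of_ae hhat))
  filter_upwards [key] with ω hω
  obtain ⟨K, hK⟩ := exists_nat_ge (L ω)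
  exact hω K hK

end PoissonModel

/-! ### From the two-sided process to the Poisson model -/

section CountingModel

variable {Ω : Type*} [m0 : MeasurableSpace Ω] {P : Measure Ω} {θ₀ : Param} {Y : ℤ → Ω → ℕ}
  {lam : ℤ → Ω → ℝ≥0}

/-- The filtration `F_0 ⊆ F_1 ⊆ …` of the counts. -/
def pastFiltration (hY : IsSETPAR P θ₀ Y lam) : Filtration ℕ m0 where
  seq i := past Y i
  mono' i j hij := iSup_le fun s => le_iSup_of_le
    (⟨s.1, s.2.trans (by exact_mod_cast hij)⟩ : {s : ℤ // s ≤ (j : ℤ)}) le_rfl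
  le' _ := iSup_le fun s => (hY.measurable s.1).comap_le

lemma poissonMeasure_real_singleton_eq (r : ℝ≥0) (k : ℕ) :
    (poissonMeasure r).real {k} = poissonWeight r k :=
  poissonMeasure_real_singleton r k

/-- A version of the intensity at time `1` which is measurable with respect to the past. -/
def initialIntensity (P : Measure Ω) (Y : ℤ → Ω → ℕ) (δ : ℝ) (ω : Ω) : ℝ :=
  max δ (-Real.log (P[(Y 1 ⁻¹' {0}).indicator (fun _ => (1 : ℝ)) | past Y 0] ω))

/-- The conditional probability of a zero count is `exp (-λ₁)`, so minus its logarithm recovers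
`λ₁`. Truncation at `δ` gives positivity everywhere and changes nothing almost surely, as `λ₁ ≥ δ`.
-/
lemma initialIntensity_ae_eq {δ ρ B : ℝ} (hb : CoefBound δ ρ B θ₀) (hδ : 0 < δ)
    (hY : IsSETPAR P θ₀ Y lam) :
    ∀ᵐ ω ∂P, initialIntensity P Y δ ω = lam 1 ω := by
  have h1 := hY.condLaw 1 {0}
  rw [sub_self] at h1
  filter_upwards [h1, hY.recursion 1] with ω e1 e2
  have hle : δ ≤ lam 1 ω := by
    rw [e2]
    exact le_intensity hb hδ _ NNReal.zero_le_coe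
  rw [initialIntensity, e1, poissonMeasure_real_singleton_eq]
  simp [poissonWeight, hle]

lemma traj_ae_eq {δ ρ B : ℝ} (hb : CoefBound δ ρ B θ₀) (hδ : 0 < δ) (hY : IsSETPAR P θ₀ Y lam) :
    ∀ᵐ ω ∂P, ∀ i : ℕ, traj θ₀ (initialIntensity P Y δ ω) (fun j => Y ((j + 1 : ℕ) : ℤ) ω) i
      = lam ((i + 1 : ℕ) : ℤ) ω := by
  filter_upwards [initialIntensity_ae_eq hb hδ hY, ae_all_iff.2 hY.recursion] with ω h1 h2 i
  induction i with
  | zero => exact h1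
  | succ i ih =>
    have e1 := h2 ((i + 1 + 1 : ℕ) : ℤ)
    have e2 : ((i + 1 + 1 : ℕ) : ℤ) - 1 = ((i + 1 : ℕ) : ℤ) := by push_cast; ring
    rw [e2, ← ih] at e1
    exact e1.symm

/-- Indices shift by one: `N i` is `Y_{i+1}`, the intensity at index `i` is `λ_{i+1}`, and `ℱ i`
contains the whole past up to time `i`, including negative times. -/
lemma IsSETPAR.poissonModel [IsFiniteMeasure P] {δ ρ B : ℝ} (hb : CoefBound δ ρ B θ₀)
    (hδ : 0 < δ) (hY : IsSETPAR P θ₀ Y lam) :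
    PoissonModel P (pastFiltration hY) θ₀ (initialIntensity P Y δ)
      (fun ω j => Y ((j + 1 : ℕ) : ℤ) ω) where
  count_meas i := Measurable.of_comap_le (le_iSup_of_le
    (⟨((i + 1 : ℕ) : ℤ), le_rfl⟩ : {s : ℤ // s ≤ ((i + 1 : ℕ) : ℤ)}) le_rfl)
  init_meas := by
    have h1 : StronglyMeasurable[past Y 0]
        (P[(Y 1 ⁻¹' {0}).indicator (fun _ => (1 : ℝ)) | past Y 0]) := stronglyMeasurable_condExp
    exact (by fun_prop : Measurable fun x : ℝ => max δ (-Real.log x)).comp h1.measurable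
  init_pos ω := hδ.trans_le (le_max_left _ _)
  law i k S hS := by
    have hle : past Y i ≤ m0 := (pastFiltration hY).le i
    have hS0 : MeasurableSet S := hle S hS
    have hmk : MeasurableSet (Y ((i + 1 : ℕ) : ℤ) ⁻¹' {k}) :=
      hY.measurable _ (measurableSet_singleton k)
    have hcond := hY.condLaw ((i + 1 : ℕ) : ℤ) {k}
    have e2 : ((i + 1 : ℕ) : ℤ) - 1 = (i : ℤ) := by push_cast; ring
    rw [e2] at hcond
    have hint : Integrable ((Y ((i + 1 : ℕ) : ℤ) ⁻¹' {k}).indicator (fun _ => (1 : ℝ))) P :=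
      (integrable_const (1 : ℝ)).indicator hmk
    have hset := setIntegral_condExp hle hint hS
    have hcond' : P[(Y ((i + 1 : ℕ) : ℤ) ⁻¹' {k}).indicator (fun _ => (1 : ℝ)) | past Y i]
        =ᵐ[P] fun ω => poissonWeight (traj θ₀ (initialIntensity P Y δ ω)
          (fun j => Y ((j + 1 : ℕ) : ℤ) ω) i) k := by
      filter_upwards [hcond, traj_ae_eq hb hδ hY] with ω h1 h2
      rw [h1, h2 i, poissonMeasure_real_singleton_eq]
    have hwint : Integrable (fun ω => poissonWeight (traj θ₀ (initialIntensity P Y δ ω)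
          (fun j => Y ((j + 1 : ℕ) : ℤ) ω) i) k) P := integrable_condExp.congr hcond'
    have hpos : ∀ ω, 0 ≤ poissonWeight (traj θ₀ (initialIntensity P Y δ ω)
          (fun j => Y ((j + 1 : ℕ) : ℤ) ω) i) k := fun ω =>
      poissonWeight_nonneg (traj_nonneg hb hδ (hδ.le.trans (le_max_left _ _)) _ i) k
    rw [integral_congr_ae (ae_restrict_of_ae hcond'), integral_indicator hmk,
      Measure.restrict_restrict hmk, integral_const, smul_eq_mul, mul_one] at hset
    rw [← ofReal_integral_eq_lintegral_ofReal hwint.integrableOn (ae_of_all _ hpos), hset,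
      measureReal_restrict_apply_univ, Set.inter_comm, ofReal_measureReal]
    rfl

end CountingModel

end SETPAR

end

theorem theorem2 {Ω : Type*} [MeasurableSpace Ω] (P : Measure Ω) [IsProbabilityMeasure P]
    (rstar : ℕ) (D : Set SETPAR.Coef) (hD : IsCompact D) (hDΘ : D ⊆ SETPAR.bigTheta)
    (θ₀ : SETPAR.Param) (hr₀ : θ₀.1 ≤ rstar) (hθ₀ : θ₀.2 ∈ interior D)
    (Y : ℤ → Ω → ℕ) (lam : ℤ → Ω → ℝ≥0) (hY : SETPAR.IsSETPAR P θ₀ Y lam)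
    (l₁ : ℝ) (hl₁ : 0 < l₁)
    (θhat : ℕ → Ω → SETPAR.Param)
    (hθhat : ∀ n : ℕ, 1 ≤ n → ∀ᵐ ω ∂P,
      SETPAR.IsMLE (SETPAR.paramSpace rstar D) l₁ (fun t : ℕ => Y (t : ℤ) ω) n (θhat n ω)) :
    (SETPAR.Nondegenerate rstar θ₀ →
      ∀ᵐ ω ∂P, Tendsto (fun n => θhat n ω) atTop (𝓝 θ₀) ∧
        ∀ᶠ n in atTop, (θhat n ω).1 = θ₀.1) ∧
    (∀ᵐ ω ∂P, Tendsto
      (fun n => Metric.infDist (θhat n ω)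
        (SETPAR.sameModel (SETPAR.paramSpace rstar D) θ₀)) atTop (𝓝 0)) := by
  have hθ₀S : θ₀ ∈ SETPAR.paramSpace rstar D := ⟨hr₀, interior_subset hθ₀⟩
  obtain ⟨δ, ρ, B, hδ, -, hbound⟩ := SETPAR.exists_coefBound hD hDΘ
  have hmle := ae_all_iff.2 fun n => ae_all_iff.2 fun hn : 1 ≤ n => hθhat n hn
  have hset := (hY.poissonModel (hbound θ₀ hθ₀S.2) hδ).ae_tendsto_infDist hD hDΘ hθ₀S hl₁
    (y := fun ω (t : ℕ) => Y (t : ℤ) ω) (fun ω => rfl) hmle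
  refine ⟨fun hnd => ?_, hset⟩
  rw [SETPAR.sameModel_eq_singleton hθ₀S hnd] at hset
  simp only [Metric.infDist_singleton] at hset
  filter_upwards [hset] with ω hω
  refine ⟨tendsto_iff_dist_tendsto_zero.2 hω, ?_⟩
  -- Thresholds are integers, so a distance below `1` forces them to coincide.
  filter_upwards [hω.eventually (gt_mem_nhds one_pos)] with n hn
  exact SETPAR.Param.fst_eq_of_dist_lt_one hn
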